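/- Let $\mathbb{F}_q$ be a finite field with $q$ elements, let $V$ be an $\mathbb{F}_q$-vector space of finite dimension $r\ge 1$, and let $G:=\mathrm{Aut}_{\mathbb{F}_q}(V)=\mathrm{GL}(V)$. Let $S_V$ be the symmetric algebra of $V$ over $\mathbb{F}_q$, let $K_V$ be its field of quotients, and let $R_V\subset K_V$ be the $\mathbb{F}_q$-subalgebra generated by the elements $\frac1v$ for all $v\in V\setminus\{0\}$, graded such that every $\frac1v$ is homogeneous of degree $-1$; thus its homogeneous part $R_{V,-n}$ of degree $-n$ is the $\mathbb{F}_q$-span of all products $\frac1{v_1}\cdots\frac1{v_n}$ with $v_1,\dots,v_n\in V\setminus\{0\}$. The group $G$ acts on $K_V$ and $R_V$ by functoriality. For a subgroup $H\subset G$ let $R_V^H$ be the ring of $H$-invariants in $R_V$, and let $R^H_{V,-n}:=R_V^H\cap R_{V,-n}$. Fix a basis of $V$, and identify automorphisms of $V$ with their matrices in this basis (the $j$-th column being the image of the $j$-th basis vector). Let $U\subset G$ be the subgroup of upper triangular matrices with all diagonal entries equal to $1$. For $1\le s\le r$ let $P_s\subset G$ be the subgroup of all matrices of block form $\begin{pmatrix}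 * & *\\ 0 & *\end{pmatrix}$ with upper left block of size $s\times s$ and lower right block of size $(r-s)\times(r-s)$, and let $L_s$ be the normal subgroup of $P_s$ of all matrices of block form $\begin{pmatrix} 1_s & *\\ 0 & *\end{pmatrix}$, where $1_s$ is the identity matrix of size $s\times s$. Thus $UL_s$ is a subgroup of $P_s$. **Theorem.** For any unipotent subgroup $H\subset G$ (that is, a subgroup such that $h-1$ is a nilpotent endomorphism of $V$ for every $h\in H$) and any integer $n\ge 0$, the space $R^H_{V,-n}$ is finite dimensional over $\mathbb{F}_q$ and $$\dim_{\mathbb{F}_q} R^H_{V,-n} \ =\ \sum_{s=1}^r \frac{|H\backslash G/L_s|}{[P_s:UL_s]}\cdot\binom{n-1}{s-1}.$$ Here $\binom{T}{k}=\frac{T(T-1)\cdots(T-k+1)}{k!}$ is the polynomial binomial coefficient, so that for $n=0$ one has $\binom{-1}{s-1}=(-1)^{s-1}$. -/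

import Mathlib

noncomputable section

namespace ReciprocalRing

section Rings

variable (F : Type*) [Field F] (V : Type*) [AddCommGroup V] [Module F V]

/-- The field `K_V` of quotients of the symmetric algebra `S_V` of `V` over `F`. -/
abbrev KV : Type _ := FractionRing (SymmetricAlgebra F V)

/-- A vector of `V`, viewed as an element of `S_V ⊆ K_V`. -/
def vec : V →ₗ[F] KV F V :=
  (Algebra.linearMap (SymmetricAlgebra F V) (KV F V)).restrictScalars F ∘ₗ SymmetricAlgebra.ι F V

/-- The `F`-subalgebra `R_V` of `K_V` generated by `1 / v` for all non-zero `v` in `V`. -/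
def RV : Subalgebra F (KV F V) :=
  Algebra.adjoin F {x | ∃ v : V, v ≠ 0 ∧ x = (vec F V v)⁻¹}

/-- The homogeneous part `R_{V,d}` of degree `d` of `R_V`, for the `ℤ`-grading in which every
generator `1 / v` has degree `-1`: it is spanned by the products of `m` generators,
where `-m = d` (so it vanishes for `d > 0`). -/
def RVdeg (d : ℤ) : Submodule F (KV F V) :=
  Submodule.span F {x | ∃ l : Multiset V, (∀ v ∈ l, v ≠ 0) ∧ -(Multiset.card l : ℤ) = d ∧
    x = (l.map fun v => (vec F V v)⁻¹).prod}

variable {F V}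

/-- The automorphism of `S_V` induced by an automorphism of `V`. -/
def symAct (g : V ≃ₗ[F] V) : SymmetricAlgebra F V ≃ₐ[F] SymmetricAlgebra F V :=
  AlgEquiv.ofAlgHom
    (SymmetricAlgebra.lift (SymmetricAlgebra.ι F V ∘ₗ (g : V →ₗ[F] V)))
    (SymmetricAlgebra.lift (SymmetricAlgebra.ι F V ∘ₗ (g.symm : V →ₗ[F] V)))
    (by ext v; simp) (by ext v; simp)

/-- The automorphism of `K_V` induced by an automorphism of `V`. -/
def act (g : V ≃ₗ[F] V) : KV F V ≃ₐ[F] KV F V :=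
  IsFractionRing.fieldEquivOfAlgEquiv F (KV F V) (KV F V) (symAct g)

theorem act_vec (g : V ≃ₗ[F] V) (v : V) : act g (vec F V v) = vec F V (g v) := by
  simp [act, vec, symAct]

/-- The ring of invariants `R_V^H`, as a subalgebra of `K_V`. -/
def invariants (H : Subgroup (V ≃ₗ[F] V)) : Subalgebra F (KV F V) :=
  RV F V ⊓ ⨅ h ∈ H, AlgHom.equalizer (act h : KV F V →ₐ[F] KV F V) (AlgHom.id F (KV F V))

theorem mem_invariants (H : Subgroup (V ≃ₗ[F] V)) (x : KV F V) :
    x ∈ invariants H ↔ x ∈ RV F V ∧ ∀ h ∈ H, act h x = x := by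
  simp [invariants, Algebra.mem_inf, Algebra.mem_iInf]

/-- The homogeneous part `R^H_{V,d}` of degree `d` of the ring of invariants. -/
def invariantsDeg (H : Subgroup (V ≃ₗ[F] V)) (d : ℤ) : Submodule F (KV F V) :=
  Subalgebra.toSubmodule (invariants H) ⊓ RVdeg F V d

/-- A subgroup of `Aut(V)` is unipotent if `h - 1` is nilpotent for each of its elements `h`. -/
def IsUnipotentSubgroup (H : Subgroup (V ≃ₗ[F] V)) : Prop :=
  ∀ h ∈ H, IsNilpotent ((h : V →ₗ[F] V) - LinearMap.id)

end Rings

section Groups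

variable {F : Type*} [Field F] {V : Type*} [AddCommGroup V] [Module F V] {r : ℕ}

theorem finite_aut [Finite F] (b : Module.Basis (Fin r) F V) : Finite (V ≃ₗ[F] V) := by
  have : Finite V := Finite.of_equiv _ b.equivFun.symm.toEquiv
  exact Finite.of_injective (fun g : V ≃ₗ[F] V => (g : V → V)) DFunLike.coe_injective

/-- A submonoid of `Aut(V)`, for `V` finite, is a subgroup. -/
def subgroupOfSubmonoid [Finite F] (b : Module.Basis (Fin r) F V) (M : Submonoid (V ≃ₗ[F] V)) :
    Subgroup (V ≃ₗ[F] V) where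
  toSubmonoid := M
  inv_mem' := by
    intro g hg
    have := finite_aut b
    have h : g⁻¹ = g ^ (orderOf g - 1) := by
      rw [inv_eq_iff_mul_eq_one, ← pow_succ', Nat.sub_add_cancel (orderOf_pos g), pow_orderOf_eq_one]
    change g⁻¹ ∈ M
    rw [h]
    exact M.pow_mem hg _

/-- The matrix of an automorphism in the basis `b` (its `j`-th column is the image of `b j`). -/
def mat (b : Module.Basis (Fin r) F V) (g : V ≃ₗ[F] V) : Matrix (Fin r) (Fin r) F :=
  LinearMap.toMatrix b b (g : V →ₗ[F] V)

theorem mat_mul (b : Module.Basis (Fin r) F V) (g h : V ≃ₗ[F] V) :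
    mat b (g * h) = mat b g * mat b h :=
  LinearMap.toMatrix_comp b b b (g : V →ₗ[F] V) (h : V →ₗ[F] V)

theorem mat_one (b : Module.Basis (Fin r) F V) : mat b 1 = 1 :=
  LinearMap.toMatrix_id b

/-- The group `U` of automorphisms given in the basis `b` by upper triangular matrices with
all diagonal entries equal to `1`. -/
def U [Finite F] (b : Module.Basis (Fin r) F V) : Subgroup (V ≃ₗ[F] V) :=
  subgroupOfSubmonoid b
    { carrier := {g | (∀ i j, j < i → mat b g i j = 0) ∧ ∀ i, mat b g i i = 1}
      one_mem' := by
        refine ⟨fun i j hij => ?_, fun i => ?_⟩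
        · rw [mat_one, Matrix.one_apply_ne hij.ne']
        · rw [mat_one, Matrix.one_apply_eq]
      mul_mem' := by
        rintro g h ⟨hg, hg1⟩ ⟨hh, hh1⟩
        refine ⟨fun i j hij => ?_, fun i => ?_⟩
        · rw [mat_mul, Matrix.mul_apply]
          refine Finset.sum_eq_zero fun k _ => ?_
          rcases lt_or_ge k i with hk | hk
          · rw [hg i k hk, zero_mul]
          · rw [hh k j (hij.trans_le hk), mul_zero]
        · rw [mat_mul, Matrix.mul_apply, Finset.sum_eq_single i]
          · rw [hg1, hh1, one_mul]
          · intro k _ hk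
            rcases lt_or_gt_of_ne hk with hk | hk
            · rw [hg i k hk, zero_mul]
            · rw [hh k i hk, mul_zero]
          · simp }

/-- The group `P_s` of automorphisms given in the basis `b` by block upper triangular matrices
whose upper left block has size `s × s` and lower right block has size `(r - s) × (r - s)`. -/
def P [Finite F] (b : Module.Basis (Fin r) F V) (s : ℕ) : Subgroup (V ≃ₗ[F] V) :=
  subgroupOfSubmonoid b
    { carrier := {g | ∀ i j : Fin r, s ≤ (i : ℕ) → (j : ℕ) < s → mat b g i j = 0}
      one_mem' := by
        intro i j hi hj
        rw [mat_one, Matrix.one_apply_ne]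
        rintro rfl
        omega
      mul_mem' := by
        intro g h hg hh i j hi hj
        rw [mat_mul, Matrix.mul_apply]
        refine Finset.sum_eq_zero fun k _ => ?_
        rcases lt_or_ge (k : ℕ) s with hk | hk
        · rw [hg i k hi hk, zero_mul]
        · rw [hh k j hk hj, mul_zero] }

/-- The subgroup `L_s` of `P_s` given in the basis `b` by block upper triangular matrices whose
upper left block is the identity matrix of size `s × s`. -/
def L [Finite F] (b : Module.Basis (Fin r) F V) (s : ℕ) : Subgroup (V ≃ₗ[F] V) :=
  P b s ⊓ subgroupOfSubmonoid b
    { carrier := {g | ∀ i j : Fin r, (j : ℕ) < s →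
        mat b g i j = (1 : Matrix (Fin r) (Fin r) F) i j}
      one_mem' := by
        intro i j _
        rw [mat_one]
      mul_mem' := by
        intro g h hg hh i j hj
        rw [mat_mul, Matrix.mul_apply]
        have : ∀ k, mat b g i k * mat b h k j =
            mat b g i k * (1 : Matrix (Fin r) (Fin r) F) k j := fun k => by rw [hh k j hj]
        rw [Finset.sum_congr rfl fun k _ => this k, ← Matrix.mul_apply, mul_one]
        exact hg i j hj }

theorem mem_U [Finite F] (b : Module.Basis (Fin r) F V) (g : V ≃ₗ[F] V) :
    g ∈ U b ↔ (∀ i j, j < i → mat b g i j = 0) ∧ ∀ i, mat b g i i = 1 := Iff.rfl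

theorem mem_P [Finite F] (b : Module.Basis (Fin r) F V) (s : ℕ) (g : V ≃ₗ[F] V) :
    g ∈ P b s ↔ ∀ i j : Fin r, s ≤ (i : ℕ) → (j : ℕ) < s → mat b g i j = 0 := Iff.rfl

theorem mem_L [Finite F] (b : Module.Basis (Fin r) F V) (s : ℕ) (g : V ≃ₗ[F] V) :
    g ∈ L b s ↔ (∀ i j : Fin r, s ≤ (i : ℕ) → (j : ℕ) < s → mat b g i j = 0) ∧
      ∀ i j : Fin r, (i : ℕ) < s → (j : ℕ) < s →
        mat b g i j = (1 : Matrix (Fin r) (Fin r) F) i j := by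
  constructor
  · rintro ⟨h1, h2⟩
    exact ⟨h1, fun i j _ hj => h2 i j hj⟩
  · rintro ⟨h1, h2⟩
    refine ⟨h1, fun i j hj => ?_⟩
    rcases lt_or_ge (i : ℕ) s with hi | hi
    · exact h2 i j hi hj
    · rw [h1 i j hi hj, Matrix.one_apply_ne]
      rintro rfl
      omega

end Groups

end ReciprocalRing

end

/-!
Let `b` be a basis of `V` with flag `V_0 ⊂ V_1 ⊂ … ⊂ V_r`. The cell of index `i` is the affine
subspace `b i + V_i`, where `V_i` is spanned by the earlier vectors; every non-zero vector is a
multiple of a vector in exactly one cell. The products of the `1 / (c i) ^ (e i)` with `c i` in the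
cell of index `i`, where the positions `i` with `e i = 0` are left out, form a basis of `R_V`.

* They span, since two different vectors `v`, `v'` of one cell satisfy
  `1 / v * 1 / v' = 1 / (v - v') * (1 / v' - 1 / v)` with `v - v'` in a smaller step of the flag
  (`inv_vec_mul_mem_cellSpan`).
* They are linearly independent by uniqueness of partial fractions, applied to each step
  `F(b 0, …, b (i - 1)) ⊂ F(b 0, …, b i)` of a tower of fields (`linearIndependent_monomial`).

A unipotent group `H` is a `p`-group, so by Kolchin's theorem it is unitriangular in some basis
(`exists_basis_isUnitriangular`). For this basis `H` preserves every cell, hence permutes the basis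
monomials, and the dimension of the invariants is the number of orbits on the monomials of degree
`-n`. The action does not change exponents. So an orbit `q` of configurations, that is of choices of
at most one vector in each cell, contributes one for each way of writing `n` as a sum of positive
integers indexed by the support of `q`. For `n > 0` this is `choose (n - 1) (s - 1)` if
the support has `s` elements. For `n = 0` only the empty configuration contributes, and the formula
`1 = ∑ N_s (-1) ^ (s - 1)`, where `N_s` is the number of orbits with support of size `s`, holds
because adding or removing the vector `b 0`, the only one in its cell, pairs up the orbits
(`sum_neg_one_pow_card_support`).

Finally, `G / L_s` is the set of linearly independent `s`-tuples in `V`. In the basis for which `H`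
is unitriangular, every `s`-dimensional subspace has a basis in echelon form, unique up to the
unitriangular matrices of size `s`. Thus every tuple is in echelon form after a change by an element
of `P_s`, which is unique modulo `U L_s`. As the actions of `H` and `P_s` commute, this gives
`|H \ G / L_s| = N_s * [P_s : U L_s]` (`card_doubleCoset`).
-/

noncomputable section

namespace ReciprocalRing

/-! ### The flag of a basis, its cells and Kolchin's theorem -/

section

variable {F : Type*} [Field F] {V : Type*} [AddCommGroup V] [Module F V] {r : ℕ}

/-- The `k`-th step of the flag of a basis: the vectors all of whose coordinates with index at
least `k` vanish. -/
def flag (b : Module.Basis (Fin r) F V) (k : ℕ) : Submodule F V where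
  carrier := {v | ∀ j : Fin r, k ≤ j → b.repr v j = 0}
  add_mem' {v w} hv hw j hj := by simp [hv j hj, hw j hj]
  zero_mem' j _ := by simp
  smul_mem' a v hv j hj := by simp [hv j hj]

theorem mem_flag {b : Module.Basis (Fin r) F V} {k : ℕ} {v : V} :
    v ∈ flag b k ↔ ∀ j : Fin r, k ≤ j → b.repr v j = 0 := Iff.rfl

/-- The affine subspace `b i + ⟨b j | j < i⟩` of `V`. -/
def cell (b : Module.Basis (Fin r) F V) (i : Fin r) : Set V :=
  {v | b.repr v i = 1 ∧ ∀ j, i < j → b.repr v j = 0}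

theorem mem_cell {b : Module.Basis (Fin r) F V} {i : Fin r} {v : V} :
    v ∈ cell b i ↔ b.repr v i = 1 ∧ ∀ j, i < j → b.repr v j = 0 := Iff.rfl

variable {b : Module.Basis (Fin r) F V}

theorem basis_mem_flag {i : Fin r} {k : ℕ} (h : (i : ℕ) < k) : b i ∈ flag b k := by
  intro j hj
  rw [b.repr_self, Finsupp.single_eq_of_ne]
  rintro rfl
  omega

theorem flag_mono {k l : ℕ} (h : k ≤ l) : flag b k ≤ flag b l :=
  fun _ hv j hj => hv j (h.trans hj)

theorem basis_mem_cell (i : Fin r) : b i ∈ cell b i := by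
  refine ⟨by simp, fun j hj => ?_⟩
  rw [b.repr_self, Finsupp.single_eq_of_ne hj.ne']

theorem sub_mem_flag_of_mem_cell {i : Fin r} {v w : V} (hv : v ∈ cell b i) (hw : w ∈ cell b i) :
    v - w ∈ flag b i := by
  intro j hj
  rcases (show i ≤ j from hj).eq_or_lt with rfl | h
  · simp [hv.1, hw.1]
  · simp [hv.2 j h, hw.2 j h]

theorem add_mem_cell {i : Fin r} {v w : V} (hv : v ∈ cell b i) (hw : w ∈ flag b i) :
    v + w ∈ cell b i :=
  ⟨by simp [hv.1, hw i le_rfl], fun j hj => by simp [hv.2 j hj, hw j hj.le]⟩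

theorem cell_subset_flag {i : Fin r} {v : V} (hv : v ∈ cell b i) {k : ℕ} (h : (i : ℕ) < k) :
    v ∈ flag b k :=
  fun j hj => hv.2 j (Fin.lt_def.2 (h.trans_le hj))

theorem ne_zero_of_mem_cell {i : Fin r} {v : V} (hv : v ∈ cell b i) : v ≠ 0 := by
  rintro rfl
  simpa using hv.1

theorem cell_unique {i j : Fin r} {v : V} (hi : v ∈ cell b i) (hj : v ∈ cell b j) : i = j := by
  by_contra h
  rcases lt_or_gt_of_ne h with h | h
  · simpa [hi.2 j h] using hj.1
  · simpa [hj.2 i h] using hi.1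

theorem flag_zero : flag b 0 = ⊥ := by
  refine (Submodule.eq_bot_iff _).2 fun v hv => ?_
  apply b.repr.injective
  ext j
  simpa using hv j (Nat.zero_le _)

theorem flag_eq_top {k : ℕ} (hk : r ≤ k) : flag b k = ⊤ :=
  (Submodule.eq_top_iff').2 fun v j hj => absurd j.2 (by omega)

theorem map_mem_of_mem_flag {M : Type*} [AddCommGroup M] [Module F M] (f : V →ₗ[F] M)
    {W : Submodule F M} {k : ℕ} (hf : ∀ i : Fin r, (i : ℕ) < k → f (b i) ∈ W) {v : V}
    (hv : v ∈ flag b k) : f v ∈ W := by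
  rw [← b.sum_repr v, map_sum]
  refine Submodule.sum_mem _ fun i _ => ?_
  rw [map_smul]
  rcases lt_or_ge (i : ℕ) k with h | h
  · exact Submodule.smul_mem _ _ (hf i h)
  · rw [hv i h, zero_smul]
    exact Submodule.zero_mem _

/-- A vector in a step of the flag either lies in the step before or is a multiple of a vector
in the corresponding cell. -/
theorem mem_flag_or_smul_mem_cell {k : ℕ} (hk : k < r) {v : V} (hv : v ∈ flag b (k + 1)) :
    v ∈ flag b k ∨ ∃ a : F, a ≠ 0 ∧ a • v ∈ cell b ⟨k, hk⟩ := by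
  by_cases h : b.repr v ⟨k, hk⟩ = 0
  · left
    intro j hj
    rcases hj.eq_or_lt with rfl | hj
    · exact h
    · exact hv j hj
  · refine Or.inr ⟨(b.repr v ⟨k, hk⟩)⁻¹, inv_ne_zero h, ?_, fun j hj => ?_⟩
    · simp [h]
    · simp [hv j (Fin.lt_def.1 hj)]

theorem exists_smul_mem_cell {v : V} (hv : v ≠ 0) : ∃ i, ∃ a : F, a ≠ 0 ∧ a • v ∈ cell b i := by
  have key : ∀ k ≤ r, v ∈ flag b k → ∃ i, ∃ a : F, a ≠ 0 ∧ a • v ∈ cell b i := by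
    intro k
    induction k with
    | zero =>
      intro _ h
      rw [flag_zero, Submodule.mem_bot] at h
      exact absurd h hv
    | succ k ih =>
      intro hk h
      rcases mem_flag_or_smul_mem_cell (show k < r by omega) h with h' | ⟨a, ha, hav⟩
      · exact ih (by omega) h'
      · exact ⟨_, a, ha, hav⟩
  exact key r le_rfl (by rw [flag_eq_top le_rfl]; trivial)

/-- `g` fixes the flag of `b` and acts trivially on its graded pieces. -/
def IsUnitriangular (b : Module.Basis (Fin r) F V) (g : V ≃ₗ[F] V) : Prop :=
  ∀ i, g (b i) ∈ cell b i

theorem IsUnitriangular.map_flag {g : V ≃ₗ[F] V} (hg : IsUnitriangular b g) {k : ℕ} {v : V}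
    (hv : v ∈ flag b k) : g v ∈ flag b k :=
  map_mem_of_mem_flag (g : V →ₗ[F] V) (fun i h => cell_subset_flag (hg i) h) hv

theorem IsUnitriangular.map_cell {g : V ≃ₗ[F] V} (hg : IsUnitriangular b g) {i : Fin r} {v : V}
    (hv : v ∈ cell b i) : g v ∈ cell b i := by
  have h := add_mem_cell (hg i) (hg.map_flag (sub_mem_flag_of_mem_cell hv (basis_mem_cell i)))
  simpa using h

/-- A unipotent automorphism in characteristic `p` has `p`-power order. -/
theorem isPGroup_of_isUnipotentSubgroup (p : ℕ) [Fact p.Prime] [CharP F p]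
    {H : Subgroup (V ≃ₗ[F] V)} (hH : IsUnipotentSubgroup H) : IsPGroup p H := by
  rintro ⟨h, hh⟩
  obtain ⟨n, hn⟩ := hH h hh
  refine ⟨n, ?_⟩
  rw [Subtype.ext_iff]
  rcases subsingleton_or_nontrivial V with hV | hV
  · ext v; exact Subsingleton.elim _ _
  have : CharP (Module.End F V) p := charP_of_injective_algebraMap
    (FaithfulSMul.algebraMap_injective F (Module.End F V)) p
  have h1 : ((h : V →ₗ[F] V) - LinearMap.id : Module.End F V) ^ p ^ n = 0 :=
    pow_eq_zero_of_le (Nat.lt_pow_self (Fact.out (p := p.Prime)).one_lt).le hn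
  have h2 := sub_pow_expChar_pow_of_commute (R := Module.End F V) p n
    (Commute.one_right (h : Module.End F V))
  rw [one_pow] at h2
  have h3 : (h : Module.End F V) ^ p ^ n = 1 := sub_eq_zero.1 (h2.symm.trans h1)
  ext v
  have h4 : ∀ m : ℕ, ∀ w, (h ^ m) w = ((h : Module.End F V) ^ m) w := by
    intro m
    induction m with
    | zero => intro w; rfl
    | succ m ih => intro w; rw [pow_succ, pow_succ]; exact ih (h w)
  simpa using (h4 _ v).trans (by rw [h3]; rfl)

/-- The fixed point behind Kolchin's theorem: a `p`-group acting on a proper quotient `V / W` of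
a finite vector space in characteristic `p` fixes a non-zero vector. -/
theorem exists_notMem_forall_sub_mem [Finite V] (p : ℕ) [Fact p.Prime] [CharP F p]
    {H : Subgroup (V ≃ₗ[F] V)} (hH : IsPGroup p H) (W : Submodule F V) (hW : W ≠ ⊤)
    (hst : ∀ h ∈ H, ∀ w ∈ W, h w ∈ W) : ∃ v, v ∉ W ∧ ∀ h ∈ H, h v - v ∈ W := by
  let ρ : H → (V ⧸ W →ₗ[F] V ⧸ W) := fun h =>
    W.mapQ W ((h : V ≃ₗ[F] V) : V →ₗ[F] V) (fun w hw => hst h h.2 w hw)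
  let : MulAction H (V ⧸ W) :=
    { smul := fun h x => ρ h x
      one_smul := by
        intro x
        obtain ⟨v, rfl⟩ := W.mkQ_surjective x
        rfl
      mul_smul := by
        intro g h x
        obtain ⟨v, rfl⟩ := W.mkQ_surjective x
        rfl }
  have hsm : ∀ (h : H) (v : V), h • (W.mkQ v) = W.mkQ ((h : V ≃ₗ[F] V) v) := fun _ _ => rfl
  have hnt : Nontrivial (V ⧸ W) := Submodule.Quotient.nontrivial_iff.2 hW
  have : Finite (V ⧸ W) := Finite.of_surjective _ W.mkQ_surjective
  have hdvd : p ∣ Nat.card (V ⧸ W) := by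
    obtain ⟨x, hx⟩ := exists_ne (0 : V ⧸ W)
    have hpx : p • x = 0 := by
      rw [← Nat.cast_smul_eq_nsmul F, CharP.cast_eq_zero, zero_smul]
    rw [← addOrderOf_eq_prime hpx hx]
    exact addOrderOf_dvd_natCard x
  have h0 : (0 : V ⧸ W) ∈ MulAction.fixedPoints H (V ⧸ W) := fun h => by
    have := hsm h 0
    simpa using this
  obtain ⟨x, hx, hx0⟩ := hH.exists_fixed_point_of_prime_dvd_card_of_fixed_point _ hdvd h0
  obtain ⟨v, rfl⟩ := W.mkQ_surjective x
  refine ⟨v, fun hv => hx0 ?_, fun h hh => ?_⟩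
  · exact ((Submodule.Quotient.mk_eq_zero W).2 hv).symm
  · exact (Submodule.Quotient.eq W).1 (hx ⟨h, hh⟩)

/-- Kolchin's theorem over a finite field: a unipotent group is unitriangular in some basis. -/
theorem exists_basis_isUnitriangular [Finite F] (b : Module.Basis (Fin r) F V)
    {H : Subgroup (V ≃ₗ[F] V)} (hH : IsUnipotentSubgroup H) :
    ∃ b' : Module.Basis (Fin r) F V, ∀ h ∈ H, IsUnitriangular b' h := by
  obtain ⟨p, hp⟩ := CharP.exists F
  have hp' : Fact p.Prime := ⟨CharP.char_is_prime F p⟩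
  have : Finite V := Finite.of_equiv _ b.equivFun.symm.toEquiv
  have hfin : Module.Finite F V := Module.Finite.of_basis b
  have hr : Module.finrank F V = r := by simpa using Module.finrank_eq_card_basis b
  have hPG := isPGroup_of_isUnipotentSubgroup p hH
  -- a unitriangular family is extended by a vector fixed modulo the span of the previous ones
  have key : ∀ k ≤ r, ∃ v : Fin k → V, LinearIndependent F v ∧
      ∀ h ∈ H, ∀ i, h (v i) - v i ∈ Submodule.span F (v '' {j | j < i}) := by
    intro k
    induction k with
    | zero => exact fun _ => ⟨Fin.elim0, linearIndependent_empty_type, fun _ _ i => i.elim0⟩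
    | succ k ih =>
      intro hk
      obtain ⟨v, hv, hs⟩ := ih (by omega)
      have hst : ∀ h ∈ H, ∀ w ∈ Submodule.span F (Set.range v),
          h w ∈ Submodule.span F (Set.range v) := by
        intro h hh w hw
        have : Submodule.span F (Set.range v) ≤
            (Submodule.span F (Set.range v)).comap (h : V →ₗ[F] V) := by
          rw [Submodule.span_le]
          rintro _ ⟨i, rfl⟩
          have h1 := Submodule.span_mono (Set.image_subset_range _ _) (hs h hh i)
          have h2 := Submodule.add_mem _ h1 (Submodule.subset_span (Set.mem_range_self i))
          simpa using h2
        exact this hw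
      have hne : Submodule.span F (Set.range v) ≠ ⊤ := by
        intro htop
        have := finrank_span_eq_card hv
        rw [htop, finrank_top, hr, Fintype.card_fin] at this
        omega
      obtain ⟨x, hx, hx'⟩ := exists_notMem_forall_sub_mem p hPG _ hne hst
      refine ⟨Fin.snoc v x, linearIndependent_finSnoc.2 ⟨hv, hx⟩, fun h hh i => ?_⟩
      refine Fin.lastCases ?_ (fun i => ?_) i
      · rw [Fin.snoc_last]
        refine Submodule.span_mono ?_ (hx' h hh)
        rintro _ ⟨j, rfl⟩
        exact ⟨j.castSucc, Fin.castSucc_lt_last j, by simp⟩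
      · rw [Fin.snoc_castSucc]
        refine Submodule.span_mono ?_ (hs h hh i)
        rintro _ ⟨j, hj, rfl⟩
        exact ⟨j.castSucc, Fin.castSucc_lt_castSucc_iff.2 hj, by simp⟩
  obtain ⟨v, hv, hs⟩ := key r le_rfl
  have hb : ⇑(basisOfLinearIndependentOfCardEqFinrank' v hv (by simp [hr])) = v := by simp
  set b' := basisOfLinearIndependentOfCardEqFinrank' v hv (by simp [hr])
  refine ⟨b', fun h hh i => ?_⟩
  have h1 : h (b' i) - b' i ∈ flag b' i := by
    have h2 := hs h hh i
    rw [← hb] at h2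
    refine Submodule.span_le.2 ?_ h2
    rintro _ ⟨j, hj, rfl⟩
    exact basis_mem_flag hj
  simpa using add_mem_cell (basis_mem_cell i) h1

end

/-! ### Partial fractions and towers of fields -/

open Polynomial in
/-- Uniqueness of partial fraction decompositions, with linear denominators: for `x`
transcendental over `L`, the element `1` and the powers of all `1 / (x + a)` are linearly
independent over `L`. -/
theorem linearIndependent_partialFractions {L K : Type*} [Field L] [Field K] [Algebra L K] {x : K}
    (hx : Transcendental L x) :
    LinearIndependent L (fun o : Option (L × ℕ) =>
      o.elim (1 : K) fun p => ((x + algebraMap L K p.1)⁻¹) ^ (p.2 + 1)) := by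
  classical
  let : Algebra L[X] K := (aeval x).toAlgebra
  have halg : ∀ p : L[X], algebraMap L[X] K p = aeval x p := fun _ => rfl
  have hinj : Function.Injective (algebraMap L[X] K) := by
    have := transcendental_iff_injective.1 hx
    exact this
  have : FaithfulSMul L[X] K := (faithfulSMul_iff_algebraMap_injective _ _).2 hinj
  refine linearIndependent_iff'.2 fun s c hc => ?_
  let d : Option (L × ℕ) → L := fun o => if o ∈ s then c o else 0
  suffices hd : ∀ o, d o = 0 by
    intro o ho
    simpa [d, ho] using hd o
  -- all pairs in `s` lie in the box `t × {0, …, N - 1}`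
  let s' : Finset (L × ℕ) := s.eraseNone
  let t : Finset L := s'.image Prod.fst
  let N : ℕ := s'.sup Prod.snd + 1
  have hbox : s ⊆ Finset.insertNone (t ×ˢ Finset.range N) := by
    intro o ho
    cases o with
    | none => simp
    | some p =>
      have hp : p ∈ s' := by simpa [s'] using ho
      rw [Finset.some_mem_insertNone, Finset.mem_product]
      exact ⟨Finset.mem_image_of_mem _ hp,
        Finset.mem_range.2 (Nat.lt_succ_of_le (Finset.le_sup (f := Prod.snd) hp))⟩
  have hsum : ∑ o ∈ Finset.insertNone (t ×ˢ Finset.range N), d o •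
      (o.elim (1 : K) fun p => ((x + algebraMap L K p.1)⁻¹) ^ (p.2 + 1)) = 0 := by
    rw [← hc]
    symm
    refine Finset.sum_subset_zero_on_sdiff hbox (fun o ho => ?_) (fun o ho => ?_)
    · simp [d, (Finset.mem_sdiff.1 ho).2]
    · simp [d, ho]
  rw [Finset.sum_insertNone, Finset.sum_product] at hsum
  have h := quo_add_sum_rem_mul_pow_inverse_unique (K := K) (s := t) (g := fun a => X + C a)
    (fun a _ => monic_X_add_C a)
    (fun a _ a' _ haa' => by
      have := isCoprime_X_sub_C_of_isUnit_sub (R := L) (a := -a) (b := -a')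
        (by rw [isUnit_iff_ne_zero]; intro h0; exact haa' (by linear_combination -h0))
      simpa using this)
    (n := fun _ => N) (gi := fun a => (x + algebraMap L K a)⁻¹)
    (fun a _ => by
      have h1 : x + algebraMap L K a = algebraMap L[X] K (X + C a) := by simp [halg]
      rw [h1]
      refine inv_mul_cancel₀ ?_
      rw [Ne, FaithfulSMul.algebraMap_eq_zero_iff]
      exact (monic_X_add_C a).ne_zero)
    (q₁ := C (d none)) (q₂ := 0) (r₁ := fun a j => C (d (some (a, j)))) (r₂ := fun _ _ => 0)
    (fun a _ j => by
      refine lt_of_le_of_lt degree_C_le ?_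
      rw [degree_X_add_C]; exact zero_lt_one)
    (fun a _ j => by
      rw [degree_X_add_C, degree_zero]; exact WithBot.bot_lt_coe _)
    (by
      simp only [halg, map_zero, zero_mul, Finset.sum_const_zero, add_zero, aeval_C]
      rw [← hsum]
      congr 1
      · simp [Algebra.smul_def]
      · refine Finset.sum_congr rfl fun a _ => ?_
        rw [Finset.sum_range]
        simp [Algebra.smul_def])
  intro o
  cases o with
  | none => simpa using h.1
  | some p =>
    by_cases hp : some p ∈ s
    · have hp' := hbox hp
      rw [Finset.some_mem_insertNone, Finset.mem_product, Finset.mem_range] at hp'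
      have := congrFun (h.2 p.1 hp'.1) ⟨p.2, hp'.2⟩
      simpa using this
    · simp [d, hp]

/-- Linear independence in a tower of fields: if each `f i` is a linearly independent family
over the `i`-th field with values in the next field, then the products of one
member from each family are linearly independent over the base. -/
theorem linearIndependent_prod_of_tower {F K : Type*} [Field F] [Field K] [Algebra F K] {n : ℕ}
    (E : ℕ → IntermediateField F K) (hE : Monotone E) {J : Fin n → Type*} (f : ∀ i, J i → K)
    (hmem : ∀ (i : Fin n) j, f i j ∈ E (i + 1)) (hf : ∀ i : Fin n, LinearIndependent (E i) (f i)) :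
    LinearIndependent F (fun j : ∀ i, J i => ∏ i, f i (j i)) := by
  induction n with
  | zero =>
    simp only [Finset.univ_eq_empty, Finset.prod_empty]
    exact LinearIndependent.of_subsingleton (ι := ∀ i, J i) (fun i => i.elim0) one_ne_zero
  | succ n ih =>
    have h1 := ih (J := fun i => J i.castSucc) (fun i => f i.castSucc)
      (fun i j => hmem i.castSucc j) (fun i => hf i.castSucc)
    have hprod : ∀ j : ∀ i : Fin n, J i.castSucc, ∏ i, f i.castSucc (j i) ∈ E n := fun j =>
      prod_mem fun i _ => hE (show (i : ℕ) + 1 ≤ n from i.2) (hmem i.castSucc (j i))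
    have h2 : LinearIndependent F
        (fun j : ∀ i : Fin n, J i.castSucc => (⟨∏ i, f i.castSucc (j i), hprod j⟩ : E n)) :=
      LinearIndependent.of_comp (E n).val.toLinearMap h1
    have h3 := linearIndependent_smul h2 (hf (Fin.last n))
    have h4 := h3.comp
      (fun j : ∀ i, J i => ((fun i : Fin n => j i.castSucc), j (Fin.last n))) (by
        intro j j' hjj'
        rw [Prod.mk.injEq] at hjj'
        funext i
        exact Fin.lastCases hjj'.2 (fun i => congrFun hjj'.1 i) i)
    convert! h4 using 2 with j
    rw [Fin.prod_univ_castSucc]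
    rfl

/-! ### Linear independence of the monomials -/

section

variable {F : Type*} [Field F] {V : Type*} [AddCommGroup V] [Module F V] {r : ℕ}

theorem algebraicIndependent_vec (b : Module.Basis (Fin r) F V) :
    AlgebraicIndependent F (fun i => vec F V (b i)) := by
  have h1 : AlgebraicIndependent F (fun i => SymmetricAlgebra.ι F V (b i)) := by
    have h := (MvPolynomial.algebraicIndependent_X (Fin r) F).map'
      (f := ((SymmetricAlgebra.equivMvPolynomial b).symm :
        MvPolynomial (Fin r) F →ₐ[F] SymmetricAlgebra F V))
      (SymmetricAlgebra.equivMvPolynomial b).symm.injective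
    convert! h using 1
    funext i
    simp
  exact h1.map' (f := IsScalarTower.toAlgHom F (SymmetricAlgebra F V) (KV F V))
    (IsFractionRing.injective _ _)

theorem vec_injective (b : Module.Basis (Fin r) F V) : Function.Injective (vec F V) := by
  have h := (algebraicIndependent_vec b).linearIndependent
  intro v w hvw
  apply b.repr.injective
  have h1 : ∀ v, vec F V v = Finsupp.linearCombination F (fun i => vec F V (b i)) (b.repr v) := by
    intro v
    conv_lhs => rw [← b.linearCombination_repr v]
    rw [Finsupp.apply_linearCombination]
    rfl
  rw [h1, h1] at hvw
  exact h hvw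

theorem vec_ne_zero (b : Module.Basis (Fin r) F V) {v : V} (hv : v ≠ 0) : vec F V v ≠ 0 := by
  rw [Ne, ← map_zero (vec F V)]
  exact fun h => hv (vec_injective b h)

variable (F) in
/-- The product of the `1 / (c i) ^ (e i)` in `K_V`; a factor with `c i = 0` and `e i = 0` is
equal to `1`. -/
def monomial (c : Fin r → V) (e : Fin r → ℕ) : KV F V := ∏ i, (vec F V (c i))⁻¹ ^ e i

/-- The pairs of a denominator `v` and an exponent `k` allowed at position `i` of a basis
monomial: either `v` lies in the `i`-th cell and `k` is positive, or the position is unused, which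
is encoded as `v = 0` and `k = 0`. -/
def IsFactor (b : Module.Basis (Fin r) F V) (i : Fin r) (v : V) (k : ℕ) : Prop :=
  (v = 0 ∧ k = 0) ∨ (v ∈ cell b i ∧ k ≠ 0)

/-- The subfield of `K_V` generated by the first `k` basis vectors. -/
def flagField (b : Module.Basis (Fin r) F V) (k : ℕ) : IntermediateField F (KV F V) :=
  IntermediateField.adjoin F ((fun i => vec F V (b i)) '' {i | (i : ℕ) < k})

theorem flagField_mono (b : Module.Basis (Fin r) F V) : Monotone (flagField b) := fun k _ hkl =>
  IntermediateField.adjoin.mono F _ _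
    (Set.image_mono fun i (hi : (i : ℕ) < k) => hi.trans_le hkl)

theorem vec_mem_flagField {b : Module.Basis (Fin r) F V} {k : ℕ} {v : V} (hv : v ∈ flag b k) :
    vec F V v ∈ flagField b k :=
  map_mem_of_mem_flag (vec F V) (W := Subalgebra.toSubmodule (flagField b k).toSubalgebra)
    (fun i h => IntermediateField.subset_adjoin F _ ⟨i, h, rfl⟩) hv

theorem transcendental_flagField (b : Module.Basis (Fin r) F V) (i : Fin r) :
    Transcendental (flagField b i) (vec F V (b i)) := by
  rw [flagField, IntermediateField.transcendental_adjoin_iff]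
  exact (algebraicIndependent_vec b).transcendental_adjoin (s := {j : Fin r | (j : ℕ) < i})
    (fun h => lt_irrefl (i : ℕ) h)

theorem linearIndependent_factor (b : Module.Basis (Fin r) F V) (i : Fin r) :
    LinearIndependent (flagField b i)
      (fun p : {p : V × ℕ // IsFactor b i p.1 p.2} => (vec F V p.1.1)⁻¹ ^ p.1.2) := by
  classical
  have h := linearIndependent_partialFractions (transcendental_flagField b i)
  let φ : {p : V × ℕ // IsFactor b i p.1 p.2} → Option (flagField b i × ℕ) := fun p =>
    if hp : p.1.1 ∈ cell b i then
      some (⟨vec F V (p.1.1 - b i),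
        vec_mem_flagField (sub_mem_flag_of_mem_cell hp (basis_mem_cell i))⟩, p.1.2 - 1)
    else none
  have hφ : Function.Injective φ := by
    rintro ⟨⟨v, k⟩, h1⟩ ⟨⟨w, l⟩, h2⟩ heq
    rcases h1 with ⟨h1, h1'⟩ | ⟨h1, h1'⟩ <;> rcases h2 with ⟨h2, h2'⟩ | ⟨h2, h2'⟩
    · dsimp only at h1 h1' h2 h2'
      subst h1 h1' h2 h2'
      rfl
    · have h1'' : v ∉ cell b i := fun h => ne_zero_of_mem_cell h h1
      simp [φ, h1'', h2] at heq
    · have h2'' : w ∉ cell b i := fun h => ne_zero_of_mem_cell h h2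
      simp [φ, h2'', h1] at heq
    · simp only [φ, h1, h2, dite_true, Option.some.injEq, Prod.mk.injEq, Subtype.mk.injEq] at heq
      have h3 := vec_injective b heq.1
      simp only [sub_left_inj] at h3
      dsimp only at h1' h2'
      have h4 : k = l := by omega
      subst h3 h4
      rfl
  convert! h.comp φ hφ using 1
  funext p
  obtain ⟨⟨v, k⟩, hp⟩ := p
  rcases hp with ⟨h1, h1'⟩ | ⟨h1, h1'⟩
  · dsimp only at h1 h1'
    subst h1 h1'
    have h0 : (0 : V) ∉ cell b i := fun h => ne_zero_of_mem_cell h rfl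
    simp [φ, h0]
  · dsimp only at h1 h1'
    have h2 : vec F V (b i) + vec F V (v - b i) = vec F V v := by rw [← map_add]; simp
    have h3 : k - 1 + 1 = k := by omega
    simp only [φ, h1, dite_true, Function.comp, Option.elim]
    rw [h3]
    congr 2
    exact h2.symm

/-- The monomials whose factors are allowed are linearly independent. -/
theorem linearIndependent_monomial (b : Module.Basis (Fin r) F V) :
    LinearIndependent F
      (fun p : {p : (Fin r → V) × (Fin r → ℕ) // ∀ i, IsFactor b i (p.1 i) (p.2 i)} =>
        monomial F p.1.1 p.1.2) := by
  have h := linearIndependent_prod_of_tower (flagField b) (flagField_mono b)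
    (J := fun i => {p : V × ℕ // IsFactor b i p.1 p.2})
    (fun i p => (vec F V p.1.1)⁻¹ ^ p.1.2)
    (by
      rintro i ⟨⟨v, k⟩, h⟩
      have hv : v ∈ flag b (i + 1) := by
        rcases h with ⟨h, -⟩ | ⟨h, -⟩
        · change v = 0 at h
          subst h
          exact zero_mem _
        · exact cell_subset_flag h (Nat.lt_succ_self _)
      exact pow_mem (inv_mem (vec_mem_flagField hv)) k)
    (linearIndependent_factor b)
  let φ : {p : (Fin r → V) × (Fin r → ℕ) // ∀ i, IsFactor b i (p.1 i) (p.2 i)} →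
      ∀ i, {p : V × ℕ // IsFactor b i p.1 p.2} := fun p i => ⟨(p.1.1 i, p.1.2 i), p.2 i⟩
  have hφ : Function.Injective φ := by
    intro p q hpq
    have h1 : ∀ i, p.1.1 i = q.1.1 i ∧ p.1.2 i = q.1.2 i := fun i => by
      simpa [φ] using congrFun hpq i
    exact Subtype.ext (Prod.ext (funext fun i => (h1 i).1) (funext fun i => (h1 i).2))
  exact h.comp φ hφ

end

/-! ### The monomial basis and its invariants -/

section

variable {F : Type*} [Field F] {V : Type*} [AddCommGroup V] [Module F V] {r : ℕ}

/-- The span of the monomials of degree `n` with one denominator in each cell. Exponents may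
vanish, so that the same monomial is given by several choices of denominators. -/
def cellSpan (b : Module.Basis (Fin r) F V) (n : ℕ) : Submodule F (KV F V) :=
  Submodule.span F {x | ∃ (c : Fin r → V) (e : Fin r → ℕ), (∀ i, c i ∈ cell b i) ∧
    ∑ i, e i = n ∧ x = monomial F c e}

/-- Multiplication by `1 / v` preserves the span of the monomials. If the monomial already contains
a power of `1 / v'` for another `v'` in the cell of `v`, then the relation
`1 / v * 1 / v' = 1 / (v - v') * (1 / v' - 1 / v)` lowers this power at the expense of a factor
from a smaller step of the flag. -/
theorem inv_vec_mul_mem_cellSpan (b : Module.Basis (Fin r) F V) {v : V} (hv0 : v ≠ 0) {n : ℕ}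
    {x : KV F V} (hx : x ∈ cellSpan b n) : (vec F V v)⁻¹ * x ∈ cellSpan b (n + 1) := by
  classical
  suffices key : ∀ k ≤ r, ∀ v ∈ flag b k, v ≠ 0 → ∀ n, ∀ x ∈ cellSpan b n,
      (vec F V v)⁻¹ * x ∈ cellSpan b (n + 1) from
    key r le_rfl v (by rw [flag_eq_top le_rfl]; trivial) hv0 n x hx
  intro k
  induction k with
  | zero =>
    intro _ v hv hv0
    rw [flag_zero, Submodule.mem_bot] at hv
    exact absurd hv hv0
  | succ k ih =>
    intro hk v hv hv0 n x hx
    have ih := ih (by omega)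
    rcases mem_flag_or_smul_mem_cell (show k < r by omega) hv with h | ⟨a, ha, hav⟩
    · exact ih v h hv0 n x hx
    set i : Fin r := ⟨k, by omega⟩
    suffices hcell : ∀ v ∈ cell b i, (vec F V v)⁻¹ * x ∈ cellSpan b (n + 1) by
      have h := hcell _ hav
      have h2 : (vec F V v)⁻¹ = a • (vec F V (a • v))⁻¹ := by
        rw [map_smul, Algebra.smul_def, Algebra.smul_def, mul_inv, mul_inv_cancel_left₀]
        simpa using ha
      rw [h2, smul_mul_assoc]
      exact Submodule.smul_mem _ _ h
    clear hv hv0 hav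
    intro v hv
    have hle : cellSpan b n ≤
        (cellSpan b (n + 1)).comap (LinearMap.mulLeft F (vec F V v)⁻¹) := by
      refine Submodule.span_le.2 ?_
      rintro _ ⟨c, e, hc, hn, rfl⟩
      change (vec F V v)⁻¹ * monomial F c e ∈ cellSpan b (n + 1)
      -- `A` collects the factors at the positions other than `i`, and `N` their degree
      let A : KV F V := ∏ j ∈ Finset.univ.erase i, (vec F V (c j))⁻¹ ^ e j
      let N : ℕ := ∑ j ∈ Finset.univ.erase i, e j
      have hA : ∀ (w : V), w ∈ cell b i → ∀ m, A * (vec F V w)⁻¹ ^ m ∈ cellSpan b (N + m) := by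
        intro w hw m
        refine Submodule.subset_span ⟨Function.update c i w, Function.update e i m, ?_, ?_, ?_⟩
        · intro j
          rcases eq_or_ne j i with rfl | hj
          · simpa using hw
          · simpa [hj] using hc j
        · rw [← Finset.sum_erase_add _ _ (Finset.mem_univ i), Function.update_self]
          congr 1
          refine Finset.sum_congr rfl fun j hj => ?_
          rw [Function.update_of_ne (Finset.ne_of_mem_erase hj)]
        · rw [monomial, ← Finset.prod_erase_mul _ _ (Finset.mem_univ i), Function.update_self,
            Function.update_self]
          congr 1
          refine Finset.prod_congr rfl fun j hj => ?_
          rw [Function.update_of_ne (Finset.ne_of_mem_erase hj),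
            Function.update_of_ne (Finset.ne_of_mem_erase hj)]
      have hB : ∀ m, ∀ w ∈ cell b i,
          (vec F V v)⁻¹ * (A * (vec F V w)⁻¹ ^ m) ∈ cellSpan b (N + m + 1) := by
        intro m
        induction m with
        | zero =>
          intro w hw
          have := hA v hv 1
          rwa [pow_zero, mul_one, mul_comm, ← pow_one (vec F V v)⁻¹]
        | succ m ihm =>
          intro w hw
          rcases eq_or_ne v w with rfl | hvw
          · have := hA v hv (m + 2)
            rwa [mul_left_comm, ← pow_succ']
          · have h1 : vec F V v ≠ 0 := vec_ne_zero b (ne_zero_of_mem_cell hv)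
            have h2 : vec F V w ≠ 0 := vec_ne_zero b (ne_zero_of_mem_cell hw)
            have h3 : vec F V v - vec F V w ≠ 0 := by
              rw [← map_sub]
              exact vec_ne_zero b (sub_ne_zero.2 hvw)
            have h4 := ih (v - w) (sub_mem_flag_of_mem_cell hv hw) (sub_ne_zero.2 hvw) _ _
              (Submodule.sub_mem _ (hA w hw (m + 1)) (ihm w hw))
            convert! h4 using 1
            rw [map_sub]
            have h5 : (vec F V v)⁻¹ * (vec F V w)⁻¹ =
                (vec F V v - vec F V w)⁻¹ * ((vec F V w)⁻¹ - (vec F V v)⁻¹) := by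
              field_simp
            rw [pow_succ]
            linear_combination (A * (vec F V w)⁻¹ ^ m) * h5
      have h6 := hB (e i) (c i) (hc i)
      have h7 : A * (vec F V (c i))⁻¹ ^ e i = monomial F c e :=
        Finset.prod_erase_mul _ _ (Finset.mem_univ i)
      have h8 : N + e i = n := by rw [← hn]; exact Finset.sum_erase_add _ _ (Finset.mem_univ i)
      rwa [h7, h8] at h6
    exact hle hx

theorem prod_mem_RVdeg (l : Multiset V) (hl : ∀ v ∈ l, v ≠ 0) :
    (l.map fun v => (vec F V v)⁻¹).prod ∈ RVdeg F V (-(Multiset.card l : ℤ)) :=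
  Submodule.subset_span ⟨l, hl, rfl, rfl⟩

theorem RVdeg_eq_cellSpan (b : Module.Basis (Fin r) F V) (n : ℕ) :
    RVdeg F V (-(n : ℤ)) = cellSpan b n := by
  apply le_antisymm
  · refine Submodule.span_le.2 ?_
    rintro _ ⟨l, hl, hn, rfl⟩
    have hn : Multiset.card l = n := by omega
    subst hn
    induction l using Multiset.induction_on with
    | empty =>
      refine Submodule.subset_span ⟨b, 0, basis_mem_cell, ?_, ?_⟩
      · simp
      · simp [monomial]
    | cons v l ih =>
      rw [Multiset.map_cons, Multiset.prod_cons, Multiset.card_cons]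
      exact inv_vec_mul_mem_cellSpan b (hl v (Multiset.mem_cons_self v l))
        (ih (fun w hw => hl w (Multiset.mem_cons_of_mem hw)) rfl)
  · refine Submodule.span_le.2 ?_
    rintro _ ⟨c, e, hc, rfl, rfl⟩
    have h := prod_mem_RVdeg (F := F) (∑ i, Multiset.replicate (e i) (c i)) (by
      intro v hv
      obtain ⟨i, -, hi⟩ := Multiset.mem_sum.1 hv
      rw [Multiset.eq_of_mem_replicate hi]
      exact ne_zero_of_mem_cell (hc i))
    convert! h using 1
    · simp
      rfl
    · rw [← Multiset.coe_mapAddMonoidHom, map_sum, Multiset.prod_sum]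
      simp [monomial]

/-- The index set of the monomial basis of the part of degree `-n`: pairs of denominators and
exponents. -/
abbrev Index (b : Module.Basis (Fin r) F V) (n : ℕ) : Type _ :=
  {p : (Fin r → V) × (Fin r → ℕ) // (∀ i, IsFactor b i (p.1 i) (p.2 i)) ∧ ∑ i, p.2 i = n}

/-- The element of the monomial basis with a given index. -/
def basisMonomial (b : Module.Basis (Fin r) F V) (n : ℕ) (p : Index b n) : KV F V :=
  monomial F p.1.1 p.1.2

theorem linearIndependent_basisMonomial (b : Module.Basis (Fin r) F V) (n : ℕ) :
    LinearIndependent F (basisMonomial b n) :=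
  (linearIndependent_monomial b).comp (fun p : Index b n => ⟨p.1, p.2.1⟩) fun p q hpq =>
    Subtype.ext (by simpa using hpq)

theorem span_basisMonomial (b : Module.Basis (Fin r) F V) (n : ℕ) :
    Submodule.span F (Set.range (basisMonomial b n)) = RVdeg F V (-(n : ℤ)) := by
  classical
  rw [RVdeg_eq_cellSpan b, cellSpan]
  congr 1
  ext x
  constructor
  · rintro ⟨⟨⟨c, e⟩, h, hn⟩, rfl⟩
    refine ⟨fun i => if c i = 0 then b i else c i, e, fun i => ?_, hn, ?_⟩
    · rcases h i with ⟨h1, -⟩ | ⟨h1, -⟩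
      · change c i = 0 at h1
        simp only [h1, if_true]
        exact basis_mem_cell i
      · change c i ∈ cell b i at h1
        simp only [ne_zero_of_mem_cell h1, if_false]
        exact h1
    · change monomial F _ _ = monomial F _ _
      rw [monomial, monomial]
      refine Finset.prod_congr rfl fun i _ => ?_
      rcases h i with ⟨h1, h2⟩ | ⟨h1, -⟩
      · change e i = 0 at h2
        simp [h2]
      · change c i ∈ cell b i at h1
        simp [ne_zero_of_mem_cell h1]
  · rintro ⟨c, e, hc, hn, rfl⟩
    refine ⟨⟨(fun i => if e i = 0 then 0 else c i, e), fun i => ?_, hn⟩, ?_⟩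
    · by_cases h : e i = 0
      · exact Or.inl ⟨by simp [h], h⟩
      · exact Or.inr ⟨by simpa [h] using hc i, h⟩
    · change monomial F _ _ = monomial F _ _
      rw [monomial, monomial]
      refine Finset.prod_congr rfl fun i _ => ?_
      by_cases h : e i = 0
      · simp [h]
      · simp [h]

theorem RVdeg_le_RV (d : ℤ) : RVdeg F V d ≤ Subalgebra.toSubmodule (RV F V) := by
  refine Submodule.span_le.2 ?_
  rintro _ ⟨l, hl, -, rfl⟩
  refine multiset_prod_mem (S := RV F V) _ fun x hx => ?_
  obtain ⟨v, hv, rfl⟩ := Multiset.mem_map.1 hx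
  exact Algebra.subset_adjoin ⟨v, hl v hv, rfl⟩

theorem act_monomial (g : V ≃ₗ[F] V) (c : Fin r → V) (e : Fin r → ℕ) :
    act g (monomial F c e) = monomial F (fun i => g (c i)) e := by
  simp [monomial, map_prod, act_vec]

theorem mem_invariantsDeg (H : Subgroup (V ≃ₗ[F] V)) (d : ℤ) (x : KV F V) :
    x ∈ invariantsDeg H d ↔ x ∈ RVdeg F V d ∧ ∀ h ∈ H, act h x = x := by
  have h1 : x ∈ invariantsDeg H d ↔ x ∈ invariants H ∧ x ∈ RVdeg F V d := Iff.rfl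
  rw [h1, mem_invariants]
  exact ⟨fun h => ⟨h.2, h.1.2⟩, fun h => ⟨⟨RVdeg_le_RV d h.1, h.2⟩, h.1⟩⟩

/-- The invariants of a group permuting a basis have a basis indexed by the orbits. Here `σ g`
describes the permutation of the basis `m` by `ρ g`, and `π` is a quotient map onto the set of
orbits. -/
theorem finrank_invariants_of_permutes {k M G X Ω : Type*} [Field k] [AddCommGroup M] [Module k M]
    [Finite X] (m : X → M) (hm : LinearIndependent k m) (ρ : G → (M ≃ₗ[k] M)) (σ : G → X → X)
    (hσ : ∀ g x, ρ g (m x) = m (σ g x)) (π : X → Ω) (hπ : Function.Surjective π)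
    (hπσ : ∀ x y, π x = π y ↔ ∃ g, σ g x = y) (W : Submodule k M)
    (hW : ∀ x, x ∈ W ↔ x ∈ Submodule.span k (Set.range m) ∧ ∀ g, ρ g x = x) :
    Module.Finite k W ∧ Module.finrank k W = Nat.card Ω := by
  have := Fintype.ofFinite X
  have : Finite Ω := Finite.of_surjective π hπ
  have := Fintype.ofFinite Ω
  have hσi : ∀ g, Function.Injective (σ g) := fun g x y hxy => hm.injective <| by
    apply (ρ g).injective
    rw [hσ, hσ, hxy]
  let Φ : (Ω → k) →ₗ[k] M := Fintype.linearCombination k m ∘ₗ LinearMap.funLeft k k π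
  have hΦ : ∀ f, Φ f = ∑ x, f (π x) • m x := fun f => rfl
  have hinj : Function.Injective Φ := by
    intro f f' hff'
    rw [hΦ, hΦ, ← sub_eq_zero, ← Finset.sum_sub_distrib] at hff'
    simp_rw [← sub_smul] at hff'
    funext ω
    obtain ⟨x, rfl⟩ := hπ ω
    exact sub_eq_zero.1 (Fintype.linearIndependent_iff.1 hm _ hff' x)
  have hperm : ∀ g (a : X → k), ρ g (∑ x, a (σ g x) • m x) = ∑ x, a x • m x := by
    intro g a
    rw [map_sum]
    simp_rw [map_smul, hσ]
    exact Function.Bijective.sum_comp (Finite.injective_iff_bijective.1 (hσi g))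
      (fun x => a x • m x)
  have hrange : LinearMap.range Φ = W := by
    ext v
    rw [hW, LinearMap.mem_range]
    constructor
    · rintro ⟨f, rfl⟩
      rw [hΦ]
      refine ⟨Submodule.sum_mem _ fun x _ => Submodule.smul_mem _ _
        (Submodule.subset_span ⟨x, rfl⟩), fun g => ?_⟩
      conv_rhs => rw [← hperm g (fun x => f (π x))]
      congr 1
      refine Finset.sum_congr rfl fun x _ => ?_
      rw [(hπσ x _).2 ⟨g, rfl⟩]
    · rintro ⟨hv, hinv⟩
      obtain ⟨a, rfl⟩ := (Submodule.mem_span_range_iff_exists_fun k).1 hv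
      have ha : ∀ g x, a (σ g x) = a x := by
        intro g x
        have h1 := (hperm g a).trans (hinv g).symm
        have h2 := (ρ g).injective h1
        rw [← sub_eq_zero, ← Finset.sum_sub_distrib] at h2
        simp_rw [← sub_smul] at h2
        exact sub_eq_zero.1 (Fintype.linearIndependent_iff.1 hm _ h2 x)
      refine ⟨fun ω => a (Function.surjInv hπ ω), ?_⟩
      rw [hΦ]
      refine Finset.sum_congr rfl fun x _ => ?_
      obtain ⟨g, hg⟩ := (hπσ _ x).1 (Function.surjInv_eq hπ (π x))
      rw [← ha g, hg]
  have e := LinearEquiv.ofInjective Φ hinj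
  rw [hrange] at e
  refine ⟨Module.Finite.equiv e, ?_⟩
  rw [← e.finrank_eq, Module.finrank_fintype_fun_eq_card, Nat.card_eq_fintype_card]

end

/-! ### Orbits of configurations -/

section

/-- The number of compositions of `n` into positive parts indexed by a non-empty set. -/
theorem card_positive_sum_eq {r : ℕ} (I : Finset (Fin r)) (hI : I.Nonempty) (n : ℕ) :
    Nat.card {e : Fin r → ℕ // (∀ i, i ∈ I ↔ e i ≠ 0) ∧ ∑ i, e i = n + 1} =
      n.choose (I.card - 1) := by
  classical
  have hpos : 0 < I.card := hI.card_pos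
  have hsum : ∀ e : Fin r → ℕ, (∀ i, i ∈ I ↔ e i ≠ 0) →
      ∑ i, e i = ∑ i ∈ I, (e i - 1) + I.card := by
    intro e he
    rw [Finset.card_eq_sum_ones, ← Finset.sum_add_distrib,
      ← Finset.sum_subset (Finset.subset_univ I) (fun i _ hi => by
        by_contra h
        exact hi ((he i).2 h))]
    refine Finset.sum_congr rfl fun i hi => ?_
    have := (he i).1 hi
    omega
  rcases lt_or_ge (n + 1) I.card with h | h
  · rw [Nat.choose_eq_zero_of_lt (by omega)]
    have : IsEmpty {e : Fin r → ℕ // (∀ i, i ∈ I ↔ e i ≠ 0) ∧ ∑ i, e i = n + 1} :=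
      ⟨fun e => by
        have h1 := hsum e.1 e.2.1
        have h2 := e.2.2
        omega⟩
    exact Nat.card_of_isEmpty
  · let E : {e : Fin r → ℕ // (∀ i, i ∈ I ↔ e i ≠ 0) ∧ ∑ i, e i = n + 1} ≃
        (I.finsuppAntidiag (n + 1 - I.card)) :=
      { toFun := fun e => ⟨Finsupp.onFinset I (fun i => e.1 i - 1) (fun i hi => by
          rw [e.2.1]; omega), by
          rw [Finset.mem_finsuppAntidiag]
          refine ⟨?_, Finsupp.support_onFinset_subset⟩
          have h1 := hsum e.1 e.2.1
          have h2 := e.2.2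
          change ∑ i ∈ I, (e.1 i - 1) = _
          omega⟩
        invFun := fun f => ⟨fun i => if i ∈ I then f.1 i + 1 else 0, by
          have h0 : ∀ i, i ∈ I ↔ (if i ∈ I then f.1 i + 1 else 0) ≠ 0 := fun i => by
            by_cases hi : i ∈ I <;> simp [hi]
          refine ⟨h0, ?_⟩
          rw [hsum _ h0]
          have h1 := (Finset.mem_finsuppAntidiag.1 f.2).1
          rw [Finset.sum_congr rfl (g := f.1) (fun i hi => by simp [hi]), h1]
          omega⟩
        left_inv := fun e => by
          ext i
          have h1 := e.2.1 i
          by_cases hi : i ∈ I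
          · have := h1.1 hi
            simp only [Finsupp.onFinset_apply, hi, if_true]
            omega
          · have h2 : e.1 i = 0 := by
              by_contra h
              exact hi (h1.2 h)
            simp [hi, h2]
        right_inv := fun f => by
          ext i
          by_cases hi : i ∈ I
          · simp [hi]
          · have h1 := (Finset.mem_finsuppAntidiag.1 f.2).2
            have h2 : f.1 i = 0 := by
              by_contra h
              exact hi (h1 (Finsupp.mem_support_iff.2 h))
            simp [hi, h2] }
    rw [Nat.card_congr E, Nat.card_eq_fintype_card, Fintype.card_coe,
      Finset.card_finsuppAntidiag_nat_eq_choose]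
    have h1 : I.card + (n + 1 - I.card) - 1 = n := by omega
    rw [h1, ← Nat.choose_symm (show n + 1 - I.card ≤ n by omega)]
    congr 1
    omega

variable {F : Type*} [Field F] {V : Type*} [AddCommGroup V] [Module F V] {r : ℕ}

/-- The choices of at most one vector in each cell of `b`; an omitted choice is encoded by the
zero vector, which lies in no cell. -/
abbrev Config (b : Module.Basis (Fin r) F V) : Type _ :=
  {c : Fin r → V // ∀ i, c i = 0 ∨ c i ∈ cell b i}

open Classical in
/-- The set of cells in which a vector is chosen. -/
def Config.support {b : Module.Basis (Fin r) F V} (c : Config b) : Finset (Fin r) :=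
  Finset.univ.filter fun i => c.1 i ≠ 0

theorem Config.mem_support {b : Module.Basis (Fin r) F V} {c : Config b} {i : Fin r} :
    i ∈ c.support ↔ c.1 i ≠ 0 := by simp [Config.support]

/-- Two configurations are equivalent if they lie in the same orbit of `H`. -/
def configSetoid (b : Module.Basis (Fin r) F V) (H : Subgroup (V ≃ₗ[F] V)) :
    Setoid (Config b) where
  r c d := ∃ h ∈ H, ∀ i, h (c.1 i) = d.1 i
  iseqv :=
    { refl := fun c => ⟨1, H.one_mem, fun _ => rfl⟩
      symm := by
        rintro c d ⟨h, hh, hcd⟩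
        refine ⟨h⁻¹, H.inv_mem hh, fun i => ?_⟩
        rw [← hcd i]
        exact h.symm_apply_apply _
      trans := by
        rintro c d e ⟨h, hh, hcd⟩ ⟨g, hg, hde⟩
        refine ⟨g * h, H.mul_mem hg hh, fun i => ?_⟩
        rw [← hde i, ← hcd i]
        rfl }

/-- The set of orbits of `H` on the configurations. -/
def ConfigOrbit (b : Module.Basis (Fin r) F V) (H : Subgroup (V ≃ₗ[F] V)) : Type _ :=
  Quotient (configSetoid b H)

/-- The common support of the configurations in an orbit. -/
def ConfigOrbit.support {b : Module.Basis (Fin r) F V} {H : Subgroup (V ≃ₗ[F] V)} :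
    ConfigOrbit b H → Finset (Fin r) :=
  Quotient.lift Config.support (by
    rintro c d ⟨h, -, hcd⟩
    ext i
    rw [Config.mem_support, Config.mem_support, ← hcd i]
    simp)

theorem finite_config [Finite F] (b : Module.Basis (Fin r) F V) : Finite (Config b) := by
  have : Finite V := Finite.of_equiv _ b.equivFun.symm.toEquiv
  exact inferInstanceAs (Finite {c : Fin r → V // ∀ i, c i = 0 ∨ c i ∈ cell b i})

theorem finite_configOrbit [Finite F] (b : Module.Basis (Fin r) F V)
    (H : Subgroup (V ≃ₗ[F] V)) : Finite (ConfigOrbit b H) := by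
  have := finite_config b
  exact inferInstanceAs (Finite (Quotient (configSetoid b H)))

theorem finite_index [Finite F] (b : Module.Basis (Fin r) F V) (n : ℕ) : Finite (Index b n) := by
  have : Finite V := Finite.of_equiv _ b.equivFun.symm.toEquiv
  have hle : ∀ (p : Index b n) i, p.1.2 i < n + 1 := fun p i =>
    Nat.lt_succ_of_le ((Finset.single_le_sum (f := p.1.2) (fun _ _ => Nat.zero_le _)
      (Finset.mem_univ i)).trans_eq p.2.2)
  refine Finite.of_injective
    (fun p : Index b n => (p.1.1, fun i => (⟨p.1.2 i, hle p i⟩ : Fin (n + 1)))) fun p q hpq => ?_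
  rw [Prod.mk.injEq] at hpq
  refine Subtype.ext (Prod.ext hpq.1 (funext fun i => ?_))
  simpa using congrFun hpq.2 i

/-- The configuration of the denominators of a basis monomial. -/
def Index.config {b : Module.Basis (Fin r) F V} {n : ℕ} (p : Index b n) : Config b :=
  ⟨p.1.1, fun i => (p.2.1 i).imp And.left And.left⟩

theorem Index.ne_zero_iff {b : Module.Basis (Fin r) F V} {n : ℕ} (p : Index b n) (i : Fin r) :
    p.1.1 i ≠ 0 ↔ p.1.2 i ≠ 0 := by
  rcases p.2.1 i with ⟨h1, h2⟩ | ⟨h1, h2⟩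
  · simp [h1, h2]
  · simp [ne_zero_of_mem_cell h1, h2]

/-- The index of the image of a basis monomial under a unitriangular automorphism. -/
def Index.map {b : Module.Basis (Fin r) F V} {n : ℕ} (g : V ≃ₗ[F] V) (hg : IsUnitriangular b g)
    (p : Index b n) : Index b n :=
  ⟨(fun i => g (p.1.1 i), p.1.2), fun i => (p.2.1 i).imp
    (fun h => ⟨(congrArg g h.1).trans (map_zero g), h.2⟩) (fun h => ⟨hg.map_cell h.1, h.2⟩), p.2.2⟩

/-- A basis of the invariants is indexed by the orbits of `H` on the monomials: these are pairs of
an orbit of configurations and a compatible exponent vector, as `H` does not change exponents. -/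
theorem finrank_invariantsDeg_eq_card [Finite F] (b : Module.Basis (Fin r) F V)
    (H : Subgroup (V ≃ₗ[F] V)) (hH : ∀ h ∈ H, IsUnitriangular b h) (n : ℕ) :
    Module.Finite F (invariantsDeg H (-(n : ℤ))) ∧
    Module.finrank F (invariantsDeg H (-(n : ℤ))) =
      Nat.card {p : ConfigOrbit b H × (Fin r → ℕ) //
        (∀ i, i ∈ p.1.support ↔ p.2 i ≠ 0) ∧ ∑ i, p.2 i = n} := by
  have := finite_index b n
  refine finrank_invariants_of_permutes (G := H) (basisMonomial b n)
    (linearIndependent_basisMonomial b n) (fun h => (act (h : V ≃ₗ[F] V)).toLinearEquiv)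
    (fun h => Index.map (h : V ≃ₗ[F] V) (hH h h.2)) (fun h p => act_monomial _ _ _)
    (fun p => ⟨(Quotient.mk _ p.config, p.1.2),
      fun i => Config.mem_support.trans (p.ne_zero_iff i), p.2.2⟩) ?_ ?_ _ ?_
  · rintro ⟨⟨q, e⟩, h1, h2⟩
    induction q using Quotient.inductionOn with
    | _ c =>
      refine ⟨⟨(c.1, e), fun i => ?_, h2⟩, rfl⟩
      have h3 : c.1 i ≠ 0 ↔ e i ≠ 0 := Config.mem_support.symm.trans (h1 i)
      by_cases h : c.1 i = 0
      · exact Or.inl ⟨h, by simpa [h] using h3⟩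
      · exact Or.inr ⟨(c.2 i).resolve_left h, h3.1 h⟩
  · intro p q
    rw [Subtype.mk.injEq]
    constructor
    · intro hpq
      obtain ⟨h1, h2⟩ := Prod.ext_iff.1 hpq
      obtain ⟨h, hh, hpq⟩ := Quotient.exact h1
      exact ⟨⟨h, hh⟩, Subtype.ext (Prod.ext (funext hpq) h2)⟩
    · rintro ⟨h, rfl⟩
      exact Prod.ext (Quotient.sound ⟨h, h.2, fun _ => rfl⟩) rfl
  · intro x
    rw [mem_invariantsDeg, span_basisMonomial]
    exact and_congr_right fun _ => ⟨fun h g => h g g.2, fun h g hg => h ⟨g, hg⟩⟩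

theorem card_configOrbit_prod_eq_sum [Finite F] (b : Module.Basis (Fin r) F V)
    (H : Subgroup (V ≃ₗ[F] V)) (n : ℕ) [Fintype (ConfigOrbit b H)] :
    Nat.card {p : ConfigOrbit b H × (Fin r → ℕ) //
        (∀ i, i ∈ p.1.support ↔ p.2 i ≠ 0) ∧ ∑ i, p.2 i = n} =
      ∑ q : ConfigOrbit b H,
        Nat.card {e : Fin r → ℕ // (∀ i, i ∈ q.support ↔ e i ≠ 0) ∧ ∑ i, e i = n} := by
  have : ∀ q : ConfigOrbit b H,
      Finite {e : Fin r → ℕ // (∀ i, i ∈ q.support ↔ e i ≠ 0) ∧ ∑ i, e i = n} := fun q => by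
    refine Finite.of_injective (β := Fin r → Fin (n + 1)) (fun e i => ⟨e.1 i,
      Nat.lt_succ_of_le ((Finset.single_le_sum (f := e.1) (fun _ _ => Nat.zero_le _)
        (Finset.mem_univ i)).trans_eq e.2.2)⟩) fun e f hef => ?_
    refine Subtype.ext (funext fun i => ?_)
    simpa using congrFun hef i
  rw [← Nat.card_sigma]
  exact Nat.card_congr
    { toFun := fun p => ⟨p.1.1, p.1.2, p.2⟩
      invFun := fun p => ⟨(p.1, p.2.1), p.2.2⟩
      left_inv := fun _ => rfl
      right_inv := fun _ => rfl }

end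

/-! ### The dimension formula in terms of orbits -/

section

variable {F : Type*} [Field F] {V : Type*} [AddCommGroup V] [Module F V] {r : ℕ}

theorem eq_of_mem_cell_zero (hr : 0 < r) {b : Module.Basis (Fin r) F V} {v : V}
    (hv : v ∈ cell b ⟨0, hr⟩) : v = b ⟨0, hr⟩ := by
  have h := sub_mem_flag_of_mem_cell hv (basis_mem_cell (b := b) ⟨0, hr⟩)
  rw [flag_zero, Submodule.mem_bot] at h
  exact sub_eq_zero.1 h

open Classical in
/-- Add the vector in the smallest cell, which has only one element, to a configuration, or
remove it. -/
def Config.toggle (hr : 0 < r) {b : Module.Basis (Fin r) F V} (c : Config b) : Config b :=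
  ⟨fun i => if i = ⟨0, hr⟩ then (if c.1 i = 0 then b i else 0) else c.1 i, fun i => by
    dsimp only
    split_ifs
    · exact Or.inr (basis_mem_cell _)
    · exact Or.inl rfl
    · exact c.2 i⟩

theorem Config.toggle_zero (hr : 0 < r) {b : Module.Basis (Fin r) F V} (c : Config b) :
    (c.toggle hr).1 ⟨0, hr⟩ = 0 ↔ c.1 ⟨0, hr⟩ ≠ 0 := by
  have h0 := ne_zero_of_mem_cell (basis_mem_cell (b := b) ⟨0, hr⟩)
  by_cases h : c.1 ⟨0, hr⟩ = 0 <;> simp [Config.toggle, h, h0]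

theorem Config.toggle_of_ne (hr : 0 < r) {b : Module.Basis (Fin r) F V} (c : Config b)
    {i : Fin r} (hi : i ≠ ⟨0, hr⟩) : (c.toggle hr).1 i = c.1 i := by
  simp [Config.toggle, hi]

theorem Config.eq_of_forall_ne (hr : 0 < r) {b : Module.Basis (Fin r) F V} {c d : Config b}
    (h0 : c.1 ⟨0, hr⟩ = 0 ↔ d.1 ⟨0, hr⟩ = 0) (h : ∀ i, i ≠ ⟨0, hr⟩ → c.1 i = d.1 i) : c = d := by
  refine Subtype.ext (funext fun i => ?_)
  rcases eq_or_ne i ⟨0, hr⟩ with rfl | hi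
  · by_cases hc : c.1 ⟨0, hr⟩ = 0
    · rw [hc, h0.1 hc]
    · rw [eq_of_mem_cell_zero hr ((c.2 _).resolve_left hc),
        eq_of_mem_cell_zero hr ((d.2 _).resolve_left (mt h0.2 hc))]
  · exact h i hi

theorem Config.toggle_toggle (hr : 0 < r) {b : Module.Basis (Fin r) F V} (c : Config b) :
    (c.toggle hr).toggle hr = c := by
  refine Config.eq_of_forall_ne hr ?_ fun i hi => ?_
  · rw [Config.toggle_zero, Ne, Config.toggle_zero, not_not]
  · rw [Config.toggle_of_ne hr _ hi, Config.toggle_of_ne hr _ hi]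

theorem Config.card_support_toggle (hr : 0 < r) {b : Module.Basis (Fin r) F V} (c : Config b) :
    (-1 : ℤ) ^ (c.toggle hr).support.card = -(-1) ^ c.support.card := by
  classical
  have key : ∀ c : Config b, c.1 ⟨0, hr⟩ = 0 →
      (-1 : ℤ) ^ (c.toggle hr).support.card = -(-1) ^ c.support.card := by
    intro c hc
    have h1 : (c.toggle hr).support = insert ⟨0, hr⟩ c.support := by
      ext i
      rw [Finset.mem_insert, Config.mem_support, Config.mem_support]
      rcases eq_or_ne i ⟨0, hr⟩ with rfl | hi
      · simp [Config.toggle_zero, hc]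
      · simp [Config.toggle_of_ne hr _ hi, hi]
    rw [h1, Finset.card_insert_of_notMem (fun h => Config.mem_support.1 h hc), pow_succ]
    ring
  by_cases hc : c.1 ⟨0, hr⟩ = 0
  · exact key c hc
  · have := key _ ((Config.toggle_zero hr c).2 hc)
    rw [Config.toggle_toggle] at this
    rw [this, neg_neg]

/-- The orbits of configurations cancel in pairs. -/
theorem sum_neg_one_pow_card_support (hr : 0 < r) (b : Module.Basis (Fin r) F V)
    (H : Subgroup (V ≃ₗ[F] V)) (hH : ∀ h ∈ H, IsUnitriangular b h) [Fintype (ConfigOrbit b H)] :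
    ∑ q : ConfigOrbit b H, (-1 : ℤ) ^ q.support.card = 0 := by
  let τ : ConfigOrbit b H → ConfigOrbit b H :=
    Quotient.map' (s₁ := configSetoid b H) (s₂ := configSetoid b H) (Config.toggle hr) (by
    rintro c d ⟨h, hh, hcd⟩
    have h0 : c.1 ⟨0, hr⟩ = 0 ↔ d.1 ⟨0, hr⟩ = 0 := by
      rw [← hcd, map_eq_zero_iff h h.injective]
    have h1 : (c.toggle hr).1 ⟨0, hr⟩ = 0 ↔ (d.toggle hr).1 ⟨0, hr⟩ = 0 := by
      rw [Config.toggle_zero, Config.toggle_zero, Ne, Ne, h0]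
    refine ⟨h, hh, fun i => ?_⟩
    rcases eq_or_ne i ⟨0, hr⟩ with rfl | hi
    · by_cases hc : (c.toggle hr).1 ⟨0, hr⟩ = 0
      · rw [hc, h1.1 hc, map_zero]
      · have h2 := (hH h hh).map_cell (((c.toggle hr).2 _).resolve_left hc)
        rw [eq_of_mem_cell_zero hr h2,
          eq_of_mem_cell_zero hr (((d.toggle hr).2 _).resolve_left (mt h1.2 hc))]
    · rw [Config.toggle_of_ne hr _ hi, Config.toggle_of_ne hr _ hi, hcd])
  refine Finset.sum_involution (fun q _ => τ q) ?_ ?_ (fun _ _ => Finset.mem_univ _) ?_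
  · rintro ⟨c⟩ -
    change (-1 : ℤ) ^ c.support.card + (-1) ^ (c.toggle hr).support.card = 0
    rw [Config.card_support_toggle, add_neg_cancel]
  · rintro ⟨c⟩ - h1 h2
    have h3 := congrArg (fun q => (-1 : ℤ) ^ (ConfigOrbit.support q).card) h2
    change (-1 : ℤ) ^ (c.toggle hr).support.card = (-1) ^ c.support.card at h3
    rw [Config.card_support_toggle] at h3
    change (-1 : ℤ) ^ c.support.card ≠ 0 at h1
    omega
  · rintro ⟨c⟩ -
    change Quotient.mk _ ((c.toggle hr).toggle hr) = _
    rw [Config.toggle_toggle]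
    rfl

theorem eq_of_support_eq_empty {b : Module.Basis (Fin r) F V} {H : Subgroup (V ≃ₗ[F] V)}
    {q q' : ConfigOrbit b H} (hq : q.support = ∅) (hq' : q'.support = ∅) : q = q' := by
  induction q using Quotient.inductionOn with
  | _ c =>
    induction q' using Quotient.inductionOn with
    | _ d =>
      change c.support = ∅ at hq
      change d.support = ∅ at hq'
      refine congrArg _ (Subtype.ext (funext fun i => ?_))
      have h1 : c.1 i = 0 := by
        by_contra h
        simpa [hq] using Config.mem_support.2 h
      have h2 : d.1 i = 0 := by
        by_contra h
        simpa [hq'] using Config.mem_support.2 h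
      rw [h1, h2]

/-- The dimension formula in terms of orbits of configurations. -/
theorem card_configOrbit_prod_eq_sum_choose [Finite F] (hr : 0 < r) (b : Module.Basis (Fin r) F V)
    (H : Subgroup (V ≃ₗ[F] V)) (hH : ∀ h ∈ H, IsUnitriangular b h) (n : ℕ) :
    (Nat.card {p : ConfigOrbit b H × (Fin r → ℕ) //
        (∀ i, i ∈ p.1.support ↔ p.2 i ≠ 0) ∧ ∑ i, p.2 i = n} : ℤ) =
      ∑ s ∈ Finset.Icc 1 r, (Nat.card {q : ConfigOrbit b H // q.support.card = s} : ℤ) *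
        Ring.choose ((n : ℤ) - 1) (s - 1) := by
  classical
  have := finite_configOrbit b H
  have := Fintype.ofFinite (ConfigOrbit b H)
  let o : ConfigOrbit b H := Quotient.mk _ ⟨0, fun _ => Or.inl rfl⟩
  have ho : o.support = ∅ := by
    refine Finset.eq_empty_of_forall_notMem fun i hi => ?_
    exact Config.mem_support.1 hi rfl
  have ho' : ∀ q : ConfigOrbit b H, q.support = ∅ ↔ q = o := fun q =>
    ⟨fun h => eq_of_support_eq_empty h ho, fun h => h ▸ ho⟩
  -- regroup the right-hand side by orbits
  have hR : ∑ s ∈ Finset.Icc 1 r, (Nat.card {q : ConfigOrbit b H // q.support.card = s} : ℤ) *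
        Ring.choose ((n : ℤ) - 1) (s - 1) =
      ∑ q ∈ Finset.univ.erase o, Ring.choose ((n : ℤ) - 1) (q.support.card - 1) := by
    have hmaps : ∀ q ∈ Finset.univ.erase o, q.support.card ∈ Finset.Icc 1 r := by
      intro q hq
      rw [Finset.mem_Icc]
      refine ⟨?_, by simpa using Finset.card_le_univ q.support⟩
      rw [Nat.one_le_iff_ne_zero, Ne, Finset.card_eq_zero, ho']
      exact Finset.ne_of_mem_erase hq
    rw [← Finset.sum_fiberwise_of_maps_to hmaps]
    refine Finset.sum_congr rfl fun s hs => ?_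
    rw [Finset.sum_congr rfl (g := fun _ => Ring.choose ((n : ℤ) - 1) (s - 1))
      (fun q hq => by rw [(Finset.mem_filter.1 hq).2]), Finset.sum_const, nsmul_eq_mul]
    congr 2
    rw [Nat.card_eq_fintype_card, Fintype.card_subtype]
    congr 1
    ext q
    simp only [Finset.mem_filter, Finset.mem_univ, true_and, Finset.mem_erase, and_true]
    refine ⟨fun h => ⟨?_, h⟩, fun h => h.2⟩
    rintro rfl
    rw [ho, Finset.card_empty] at h
    have := (Finset.mem_Icc.1 hs).1
    omega
  rw [hR, card_configOrbit_prod_eq_sum, Nat.cast_sum,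
    ← Finset.add_sum_erase _ _ (Finset.mem_univ o)]
  rcases n with _ | n
  · -- degree zero: only the empty configuration contributes on the left
    have h1 : Nat.card {e : Fin r → ℕ // (∀ i, i ∈ o.support ↔ e i ≠ 0) ∧ ∑ i, e i = 0} = 1 := by
      rw [ho, Nat.card_eq_one_iff_unique]
      refine ⟨⟨fun e f => Subtype.ext (funext fun i => ?_)⟩, ⟨⟨0, by simp, by simp⟩⟩⟩
      have h2 := e.2.1 i
      have h3 := f.2.1 i
      simp only [Finset.notMem_empty, false_iff, not_not] at h2 h3
      rw [h2, h3]
    have h2 : ∀ q ∈ Finset.univ.erase o, (Nat.card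
        {e : Fin r → ℕ // (∀ i, i ∈ q.support ↔ e i ≠ 0) ∧ ∑ i, e i = 0} : ℤ) = 0 := by
      intro q hq
      obtain ⟨i, hi⟩ := Finset.nonempty_iff_ne_empty.2
        (mt (ho' q).1 (Finset.ne_of_mem_erase hq))
      have : IsEmpty {e : Fin r → ℕ // (∀ i, i ∈ q.support ↔ e i ≠ 0) ∧ ∑ i, e i = 0} :=
        ⟨fun e => (e.2.1 i).1 hi (Finset.sum_eq_zero_iff.1 e.2.2 i (Finset.mem_univ i))⟩
      rw [Nat.card_of_isEmpty, Nat.cast_zero]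
    rw [h1, Finset.sum_eq_zero h2]
    have h3 := sum_neg_one_pow_card_support hr b H hH
    rw [← Finset.add_sum_erase _ _ (Finset.mem_univ o), ho, Finset.card_empty, pow_zero] at h3
    have h4 : ∀ q ∈ Finset.univ.erase o, Ring.choose (((0 : ℕ) : ℤ) - 1) (q.support.card - 1) =
        -(-1) ^ q.support.card := by
      intro q hq
      have h5 : q.support.card ≠ 0 := by
        rw [Ne, Finset.card_eq_zero, ho']
        exact Finset.ne_of_mem_erase hq
      obtain ⟨m, hm⟩ := Nat.exists_eq_succ_of_ne_zero h5
      rw [hm, Nat.cast_zero, zero_sub, Nat.succ_sub_one, Ring.choose_neg', pow_succ]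
      rw [Ring.multichoose_one, Units.smul_def, Int.coe_negOnePow_natCast]
      simp
    rw [Finset.sum_congr rfl h4, Finset.sum_neg_distrib, Nat.cast_one]
    linarith
  · have h1 : Nat.card {e : Fin r → ℕ // (∀ i, i ∈ o.support ↔ e i ≠ 0) ∧
        ∑ i, e i = n + 1} = 0 := by
      rw [ho]
      have : IsEmpty {e : Fin r → ℕ // (∀ i, i ∈ (∅ : Finset (Fin r)) ↔ e i ≠ 0) ∧
          ∑ i, e i = n + 1} := ⟨fun e => by
        have h2 : ∑ i, e.1 i = 0 := Finset.sum_eq_zero fun i _ => by simpa using e.2.1 i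
        have := e.2.2
        omega⟩
      exact Nat.card_of_isEmpty
    rw [h1, Nat.cast_zero, zero_add]
    refine Finset.sum_congr rfl fun q hq => ?_
    rw [card_positive_sum_eq _ (Finset.nonempty_iff_ne_empty.2
      (mt (ho' q).1 (Finset.ne_of_mem_erase hq))), Nat.cast_succ, add_sub_cancel_right,
      Ring.choose_natCast]

end

/-! ### Echelon bases and the groups `U`, `P_s`, `L_s` -/

section

variable {F : Type*} [Field F] {V : Type*} [AddCommGroup V] [Module F V] {r : ℕ}

/-- Vectors from distinct cells are linearly independent. -/
theorem linearIndependent_of_mem_cell {b : Module.Basis (Fin r) F V} {ι : Type*} [Finite ι]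
    {κ : ι → Fin r} (hκ : Function.Injective κ) {w : ι → V} (hw : ∀ i, w i ∈ cell b (κ i)) :
    LinearIndependent F w := by
  classical
  have := Fintype.ofFinite ι
  refine Fintype.linearIndependent_iff.2 fun a ha => ?_
  by_contra! hne
  obtain ⟨i, hi⟩ := hne
  obtain ⟨m, hm, hmax⟩ := Finset.exists_max_image (Finset.univ.filter fun i => a i ≠ 0) κ
    ⟨i, by simpa using hi⟩
  have h1 : b.repr (∑ i, a i • w i) (κ m) = 0 := by simp [ha]
  rw [map_sum, Finsupp.finsetSum_apply, Finset.sum_eq_single m] at h1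
  · rw [map_smul, Finsupp.smul_apply, (hw m).1, smul_eq_mul, mul_one] at h1
    exact (Finset.mem_filter.1 hm).2 h1
  · intro j _ hj
    by_cases haj : a j = 0
    · simp [haj]
    · have h2 : κ j < κ m := lt_of_le_of_ne (hmax j (by simpa using haj)) (hκ.ne hj)
      rw [map_smul, Finsupp.smul_apply, (hw j).2 _ h2, smul_zero]
  · simp

theorem exists_linearEquiv_apply_eq [FiniteDimensional F V] {ι : Type*} [Finite ι] {v w : ι → V}
    (hv : LinearIndependent F v) (hw : LinearIndependent F w) :
    ∃ g : V ≃ₗ[F] V, ∀ i, g (v i) = w i := by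
  let f := (Module.Basis.span hv).equiv (Module.Basis.span hw) (Equiv.refl ι)
  obtain ⟨g, hg⟩ := Submodule.exists_linearEquiv_restrict_eq f
  refine ⟨g, fun i => ?_⟩
  have h1 := hg (Module.Basis.span hv i)
  rw [Module.Basis.equiv_apply, Module.Basis.span_apply, Module.Basis.span_apply] at h1
  exact h1.symm

/-- Every subspace has a basis in echelon form with respect to `b`. -/
theorem exists_echelon_basis (b : Module.Basis (Fin r) F V) (W : Submodule F V) {s : ℕ}
    (hs : Module.finrank F W = s) :
    ∃ (ι : Fin s → Fin r) (w : Fin s → V), StrictMono ι ∧ ∀ j, w j ∈ W ∧ w j ∈ cell b (ι j) := by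
  classical
  let I : Finset (Fin r) := Finset.univ.filter fun i => ∃ v ∈ W, v ∈ cell b i
  have hI : ∀ i : I, ∃ v ∈ W, v ∈ cell b i := fun i => (Finset.mem_filter.1 i.2).2
  choose w hwW hwc using hI
  have hli : LinearIndependent F w := linearIndependent_of_mem_cell Subtype.coe_injective hwc
  have hsp : ∀ k ≤ r, ∀ v ∈ W, v ∈ flag b k → v ∈ Submodule.span F (Set.range w) := by
    intro k
    induction k with
    | zero =>
      intro _ v _ hv
      rw [flag_zero, Submodule.mem_bot] at hv
      rw [hv]
      exact zero_mem _
    | succ k ih =>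
      intro hk v hvW hv
      have ih := ih (by omega)
      rcases mem_flag_or_smul_mem_cell (show k < r by omega) hv with h | ⟨a, ha, hav⟩
      · exact ih v hvW h
      · have haW := W.smul_mem a hvW
        let i : I := ⟨⟨k, by omega⟩, Finset.mem_filter.2 ⟨Finset.mem_univ _, _, haW, hav⟩⟩
        have h1 := ih _ (W.sub_mem haW (hwW i)) (sub_mem_flag_of_mem_cell hav (hwc i))
        have h2 := Submodule.add_mem _ h1 (Submodule.subset_span (Set.mem_range_self i))
        rw [sub_add_cancel] at h2
        exact (Submodule.smul_mem_iff _ ha).1 h2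
  have hspan : Submodule.span F (Set.range w) = W := by
    refine le_antisymm (Submodule.span_le.2 ?_) fun v hv => hsp r le_rfl v hv ?_
    · rintro _ ⟨i, rfl⟩
      exact hwW i
    · rw [flag_eq_top le_rfl]
      trivial
  have hcard : I.card = s := by
    rw [← hs, ← hspan, finrank_span_eq_card hli, Fintype.card_coe]
  exact ⟨I.orderEmbOfFin hcard, fun j => w ⟨_, I.orderEmbOfFin_mem hcard j⟩,
    (I.orderEmbOfFin hcard).strictMono, fun j => ⟨hwW _, hwc _⟩⟩

theorem mat_apply (b : Module.Basis (Fin r) F V) (g : V ≃ₗ[F] V) (i j : Fin r) :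
    mat b g i j = b.repr (g (b j)) i := by
  simp [mat, LinearMap.toMatrix_apply]

section Groups

variable [Finite F] (b : Module.Basis (Fin r) F V)

theorem mem_P_iff {s : ℕ} {g : V ≃ₗ[F] V} :
    g ∈ P b s ↔ ∀ j : Fin r, (j : ℕ) < s → g (b j) ∈ flag b s := by
  simp only [mem_P, mat_apply, mem_flag]
  exact ⟨fun h j hj i hi => h i j hi hj, fun h i j hi hj => h j hj i hi⟩

theorem mem_L_iff {s : ℕ} {g : V ≃ₗ[F] V} :
    g ∈ L b s ↔ ∀ j : Fin r, (j : ℕ) < s → g (b j) = b j := by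
  rw [mem_L]
  simp only [mat_apply]
  constructor
  · intro h j hj
    apply b.repr.injective
    ext i
    rw [b.repr_self]
    rcases lt_or_ge (i : ℕ) s with hi | hi
    · rw [h.2 i j hi hj, Matrix.one_apply, Finsupp.single_apply]
      simp [eq_comm]
    · rw [h.1 i j hi hj, Finsupp.single_eq_of_ne]
      rintro rfl
      omega
  · intro h
    refine ⟨fun i j hi hj => ?_, fun i j _ hj => ?_⟩
    · rw [h j hj, b.repr_self, Finsupp.single_eq_of_ne]
      rintro rfl
      omega
    · rw [h j hj, b.repr_self, Matrix.one_apply, Finsupp.single_apply]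
      simp [eq_comm]

theorem mem_U_iff {g : V ≃ₗ[F] V} : g ∈ U b ↔ IsUnitriangular b g := by
  simp only [mem_U, mat_apply, IsUnitriangular, mem_cell]
  exact ⟨fun h i => ⟨h.2 i, fun j hj => h.1 j i hj⟩,
    fun h => ⟨fun i j hj => (h j).2 i hj, fun i => (h i).1⟩⟩

/-- The group `U L_s` consists of the automorphisms whose first `s` columns are unitriangular. -/
theorem mem_U_sup_L_iff {s : ℕ} {g : V ≃ₗ[F] V} :
    g ∈ U b ⊔ L b s ↔ ∀ j : Fin r, (j : ℕ) < s → g (b j) ∈ cell b j := by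
  have := Module.Finite.of_basis b
  constructor
  · let T : Subgroup (V ≃ₗ[F] V) := subgroupOfSubmonoid b
      { carrier := {g | ∀ j : Fin r, (j : ℕ) < s → g (b j) ∈ cell b j}
        one_mem' := fun j _ => basis_mem_cell j
        mul_mem' := by
          intro g h hg hh j hj
          have h1 := sub_mem_flag_of_mem_cell (hh j hj) (basis_mem_cell j)
          have h2 := add_mem_cell (hg j hj) (map_mem_of_mem_flag (g : V →ₗ[F] V)
            (fun i hi => cell_subset_flag (hg i (hi.trans hj)) hi) h1)
          rw [LinearEquiv.coe_coe, map_sub, add_sub_cancel] at h2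
          exact h2 }
    have hU : U b ≤ T := fun u hu j _ => (mem_U_iff b).1 hu j
    have hL : L b s ≤ T := fun l hl j hj => by
      rw [(mem_L_iff b).1 hl j hj]
      exact basis_mem_cell j
    exact fun hg => sup_le hU hL hg
  · intro hg
    let f : Fin r → V := fun j => if (j : ℕ) < s then g (b j) else b j
    have hf : ∀ j, f j ∈ cell b j := fun j => by
      by_cases hj : (j : ℕ) < s
      · simpa [f, hj] using hg j hj
      · simpa [f, hj] using basis_mem_cell j
    obtain ⟨u, hu⟩ := exists_linearEquiv_apply_eq b.linearIndependent
      (linearIndependent_of_mem_cell Function.injective_id hf)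
    have huU : u ∈ U b := (mem_U_iff b).2 fun j => by rw [hu]; exact hf j
    have hl : u⁻¹ * g ∈ L b s := (mem_L_iff b).2 fun j hj => by
      have h1 : u (b j) = g (b j) := by rw [hu]; simp [f, hj]
      change u.symm (g (b j)) = b j
      rw [← h1, u.symm_apply_apply]
    have := Subgroup.mul_mem_sup huU hl
    rwa [mul_inv_cancel_left] at this

theorem L_fix_flag {s : ℕ} {l : V ≃ₗ[F] V} (hl : l ∈ L b s) {v : V} (hv : v ∈ flag b s) :
    l v = v := by
  have h := map_mem_of_mem_flag (b := b) ((l : V →ₗ[F] V) - LinearMap.id) (W := ⊥)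
    (fun i hi => by simp [(mem_L_iff b).1 hl i hi]) hv
  exact sub_eq_zero.1 ((Submodule.mem_bot F).1 h)

theorem conj_mem_L {s : ℕ} {p l : V ≃ₗ[F] V} (hp : p ∈ P b s) (hl : l ∈ L b s) :
    p⁻¹ * l * p ∈ L b s := (mem_L_iff b).2 fun j hj => by
  change p.symm (l (p (b j))) = b j
  rw [L_fix_flag b hl ((mem_P_iff b).1 hp j hj), p.symm_apply_apply]

end Groups

end

/-! ### Double cosets -/

section

variable {F : Type*} [Field F] {V : Type*} [AddCommGroup V] [Module F V] {r : ℕ}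

/-- The images under `g` of the first `s` vectors of `b` lie in distinct cells of `b'`, in
increasing order; the cell of the image of `b j` is the one with index `κ j`. -/
def IsEchelon (b b' : Module.Basis (Fin r) F V) {s : ℕ} (hs : s ≤ r) (κ : Fin s → Fin r)
    (g : V ≃ₗ[F] V) : Prop :=
  StrictMono κ ∧ ∀ j, g (b (Fin.castLE hs j)) ∈ cell b' (κ j)

variable {b b' : Module.Basis (Fin r) F V} {s : ℕ} {hs : s ≤ r} {κ : Fin s → Fin r}
  {g : V ≃ₗ[F] V}

theorem IsEchelon.mul_left (hg : IsEchelon b b' hs κ g) {h : V ≃ₗ[F] V}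
    (hh : IsUnitriangular b' h) : IsEchelon b b' hs κ (h * g) :=
  ⟨hg.1, fun j => hh.map_cell (hg.2 j)⟩

theorem IsEchelon.map_flag (hg : IsEchelon b b' hs κ g) (j : Fin s) {v : V}
    (hv : v ∈ flag b j) : g v ∈ flag b' (κ j) :=
  map_mem_of_mem_flag (g : V →ₗ[F] V) (fun i h => cell_subset_flag (hg.2 ⟨i, h.trans j.2⟩)
    (hg.1 (Fin.lt_def.2 h))) hv

theorem IsEchelon.mul_right [Finite F] (hg : IsEchelon b b' hs κ g) {x : V ≃ₗ[F] V}
    (hx : x ∈ U b ⊔ L b s) : IsEchelon b b' hs κ (g * x) := by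
  refine ⟨hg.1, fun j => ?_⟩
  have h1 := (mem_U_sup_L_iff b).1 hx (Fin.castLE hs j) j.2
  have h2 := add_mem_cell (hg.2 j)
    (hg.map_flag j (sub_mem_flag_of_mem_cell h1 (basis_mem_cell _)))
  rw [map_sub, add_sub_cancel] at h2
  exact h2

/-- The image under `g` of the `s`-th step of the flag of `b` meets only the cells of index `κ j`,
and it meets such a cell only in images of vectors from the step `j + 1`. -/
theorem IsEchelon.mem_range (hg : IsEchelon b b' hs κ g) {v : V} (hv : v ∈ flag b s) {i : Fin r}
    (hi : g v ∈ cell b' i) : ∃ j : Fin s, i = κ j ∧ v ∈ flag b (j + 1) := by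
  have key : ∀ k ≤ s, v ∈ flag b k → ∃ j : Fin s, i = κ j ∧ v ∈ flag b (j + 1) := by
    intro k
    induction k with
    | zero =>
      intro _ h
      rw [flag_zero, Submodule.mem_bot] at h
      rw [h, map_zero] at hi
      exact absurd rfl (ne_zero_of_mem_cell hi)
    | succ k ih =>
      intro hk h
      rcases mem_flag_or_smul_mem_cell (show k < r by omega) h with h' | ⟨a, ha, hav⟩
      · exact ih (by omega) h'
      · refine ⟨⟨k, hk⟩, ?_, h⟩
        have h1 := add_mem_cell (hg.2 ⟨k, hk⟩)
          (hg.map_flag ⟨k, hk⟩ (sub_mem_flag_of_mem_cell hav (basis_mem_cell _)))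
        have h2 : Fin.castLE hs ⟨k, hk⟩ = ⟨k, by omega⟩ := rfl
        rw [map_sub, h2, add_sub_cancel, map_smul] at h1
        -- a multiple of `g v` lies in the cell of index `κ k`
        by_contra hne
        rcases lt_or_gt_of_ne hne with hlt | hlt
        · have h3 := h1.1
          rw [map_smul, Finsupp.smul_apply, hi.2 _ hlt, smul_zero] at h3
          exact zero_ne_one h3
        · have h3 := h1.2 _ hlt
          rw [map_smul, Finsupp.smul_apply, hi.1, smul_eq_mul, mul_one] at h3
          exact ha h3
  exact key s le_rfl hv

/-- Two echelon bases of the same subspace differ by a unitriangular matrix. -/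
theorem IsEchelon.mem_U_sup_L [Finite F] (hg : IsEchelon b b' hs κ g) {κ' : Fin s → Fin r}
    {p : V ≃ₗ[F] V} (hp : p ∈ P b s) (hgp : IsEchelon b b' hs κ' (g * p)) :
    p ∈ U b ⊔ L b s := by
  have hmem : ∀ j : Fin s, p (b (Fin.castLE hs j)) ∈ flag b s := fun j =>
    (mem_P_iff b).1 hp _ j.2
  have hκ : κ' = κ := by
    have h1 : ∀ j, κ' j ∈ Set.range κ := fun j => by
      obtain ⟨i, hi, -⟩ := hg.mem_range (hmem j) (hgp.2 j)
      exact ⟨i, hi.symm⟩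
    choose f hf using h1
    have hf' : StrictMono f := fun i j hij => by
      rw [← hg.1.lt_iff_lt, hf, hf]
      exact hgp.1 hij
    have hfid : f = id := hf'.eq_id
    funext j
    rw [← hf j, hfid]
    rfl
  subst hκ
  refine (mem_U_sup_L_iff b).2 fun j hj => ?_
  have hmem' := hmem ⟨j, hj⟩
  have hgp' := hgp.2 ⟨j, hj⟩
  change p (b j) ∈ flag b s at hmem'
  change g (p (b j)) ∈ cell b' (κ' ⟨j, hj⟩) at hgp'
  suffices h : p (b j) - b j ∈ flag b j by simpa using add_mem_cell (basis_mem_cell j) h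
  have h1 : p (b j) - b j ∈ flag b s := Submodule.sub_mem _ hmem' (basis_mem_flag hj)
  have h2 : g (p (b j) - b j) ∈ flag b' (κ' ⟨j, hj⟩) := by
    rw [map_sub]
    exact sub_mem_flag_of_mem_cell hgp' (hg.2 ⟨j, hj⟩)
  by_cases h0 : p (b j) - b j = 0
  · rw [h0]
    exact Submodule.zero_mem _
  -- a multiple of `g (p (b j) - b j)` lies in some cell, whose index must be less than `κ' j`
  obtain ⟨i, a, ha, hai⟩ := exists_smul_mem_cell (b := b')
    (mt (map_eq_zero_iff g g.injective).1 h0)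
  rw [← map_smul] at hai
  obtain ⟨k, rfl, hk⟩ := hg.mem_range (Submodule.smul_mem _ a h1) hai
  have hlt : κ' k < κ' ⟨j, hj⟩ := by
    by_contra hle
    rw [map_smul] at hai
    have h3 := hai.1
    rw [map_smul, Finsupp.smul_apply, h2 _ (not_lt.1 hle), smul_zero] at h3
    exact zero_ne_one h3
  rw [hg.1.lt_iff_lt] at hlt
  exact flag_mono (show (k : ℕ) + 1 ≤ j from hlt) ((Submodule.smul_mem_iff _ ha).1 hk)

theorem linearIndependent_castLE (b : Module.Basis (Fin r) F V) (hs : s ≤ r) :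
    LinearIndependent F (fun j : Fin s => b (Fin.castLE hs j)) :=
  b.linearIndependent.comp _ (Fin.castLE_injective hs)

theorem span_castLE (b : Module.Basis (Fin r) F V) (hs : s ≤ r) :
    Submodule.span F (Set.range fun j : Fin s => b (Fin.castLE hs j)) = flag b s := by
  refine le_antisymm (Submodule.span_le.2 ?_) fun v hv => ?_
  · rintro _ ⟨j, rfl⟩
    exact basis_mem_flag j.2
  · exact map_mem_of_mem_flag LinearMap.id
      (fun i h => Submodule.subset_span (Set.mem_range.2 ⟨⟨i, h⟩, rfl⟩)) hv

theorem exists_mem_P_isEchelon [Finite F] (b b' : Module.Basis (Fin r) F V) (hs : s ≤ r)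
    (g : V ≃ₗ[F] V) : ∃ p ∈ P b s, ∃ κ, IsEchelon b b' hs κ (g * p) := by
  have := Module.Finite.of_basis b
  obtain ⟨κ, w, hκ, hw⟩ := exists_echelon_basis b' ((flag b s).map (g : V →ₗ[F] V)) (s := s) (by
    rw [LinearEquiv.finrank_map_eq, ← span_castLE b hs,
      finrank_span_eq_card (linearIndependent_castLE b hs), Fintype.card_fin])
  obtain ⟨f, hf⟩ := exists_linearEquiv_apply_eq (linearIndependent_castLE b hs)
    (linearIndependent_of_mem_cell hκ.injective fun j => (hw j).2)
  refine ⟨g⁻¹ * f, (mem_P_iff b).2 fun j hj => ?_, κ, hκ, fun j => ?_⟩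
  · obtain ⟨v, hv, hgv⟩ := (hw ⟨j, hj⟩).1
    have h1 : f (b j) = w ⟨j, hj⟩ := hf ⟨j, hj⟩
    change g.symm (f (b j)) ∈ flag b s
    rw [h1, ← hgv]
    simpa using hv
  · rw [mul_inv_cancel_left, hf]
    exact (hw j).2

/-- The configuration `c` consists of the images under `g` of the first `s` vectors of `b`. -/
def Represents (b b' : Module.Basis (Fin r) F V) {s : ℕ} (hs : s ≤ r) (g : V ≃ₗ[F] V)
    (c : Config b') : Prop :=
  ∃ κ : Fin s → Fin r, IsEchelon b b' hs κ g ∧ (∀ i, i ∈ c.support ↔ i ∈ Set.range κ) ∧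
    ∀ j, c.1 (κ j) = g (b (Fin.castLE hs j))

theorem exists_represents (b : Module.Basis (Fin r) F V) (hs : s ≤ r) (c : Config b')
    (hc : c.support.card = s) : ∃ g, Represents b b' hs g c := by
  have := Module.Finite.of_basis b
  have hcell : ∀ j, c.1 (c.support.orderEmbOfFin hc j) ∈ cell b' (c.support.orderEmbOfFin hc j) :=
    fun j => (c.2 _).resolve_left (Config.mem_support.1 (c.support.orderEmbOfFin_mem hc j))
  obtain ⟨g, hg⟩ := exists_linearEquiv_apply_eq (linearIndependent_castLE b hs)
    (linearIndependent_of_mem_cell (c.support.orderEmbOfFin hc).injective hcell)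
  refine ⟨g, c.support.orderEmbOfFin hc, ⟨(c.support.orderEmbOfFin hc).strictMono, fun j => ?_⟩,
    fun i => ?_, fun j => (hg j).symm⟩
  · rw [hg]
    exact hcell j
  · rw [Finset.range_orderEmbOfFin, Finset.mem_coe]

theorem IsEchelon.exists_represents (hg : IsEchelon b b' hs κ g) :
    ∃ c : Config b', c.support.card = s ∧ Represents b b' hs g c := by
  classical
  have hext : ∀ j, Function.extend κ (fun j => g (b (Fin.castLE hs j))) 0 (κ j) =
      g (b (Fin.castLE hs j)) := hg.1.injective.extend_apply _ _
  have hext' : ∀ i, i ∉ Set.range κ →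
      Function.extend κ (fun j => g (b (Fin.castLE hs j))) 0 i = 0 := fun i hi =>
    Function.extend_apply' _ _ _ hi
  let c : Config b' := ⟨Function.extend κ (fun j => g (b (Fin.castLE hs j))) 0, fun i => by
    by_cases hi : i ∈ Set.range κ
    · obtain ⟨j, rfl⟩ := hi
      rw [hext]
      exact Or.inr (hg.2 j)
    · exact Or.inl (hext' i hi)⟩
  have hsupp : ∀ i, i ∈ c.support ↔ i ∈ Set.range κ := fun i => by
    rw [Config.mem_support]
    constructor
    · intro h
      by_contra hi
      exact h (hext' i hi)
    · rintro ⟨j, rfl⟩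
      exact (hext j).trans_ne (ne_zero_of_mem_cell (hg.2 j))
  refine ⟨c, ?_, κ, hg, hsupp, hext⟩
  have h1 : c.support = Finset.univ.image κ := by
    ext i
    simp [hsupp]
  rw [h1, Finset.card_image_of_injective _ hg.1.injective, Finset.card_univ, Fintype.card_fin]

theorem Represents.apply_eq {g' : V ≃ₗ[F] V} {c d : Config b'} (hg : Represents b b' hs g c)
    (hg' : Represents b b' hs g' d) {h : V ≃ₗ[F] V} (hcd : ∀ i, h (c.1 i) = d.1 i) (j : Fin s) :
    h (g (b (Fin.castLE hs j))) = g' (b (Fin.castLE hs j)) := by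
  obtain ⟨κ, hκ, hc, hcg⟩ := hg
  obtain ⟨κ', hκ', hd, hdg⟩ := hg'
  have h1 : κ = κ' := by
    refine (StrictMono.range_inj hκ.1 hκ'.1).1 (Set.ext fun i => ?_)
    rw [← hc, ← hd, Config.mem_support, Config.mem_support, ← hcd i]
    simp
  subst h1
  rw [← hcg, ← hdg, hcd]

theorem Represents.config_eq {g' : V ≃ₗ[F] V} {c d : Config b'} (hg : Represents b b' hs g c)
    (hg' : Represents b b' hs g' d) {h : V ≃ₗ[F] V}
    (hgg : ∀ j : Fin s, h (g (b (Fin.castLE hs j))) = g' (b (Fin.castLE hs j)))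
    (hh : IsUnitriangular b' h) (i : Fin r) : h (c.1 i) = d.1 i := by
  obtain ⟨κ, hκ, hc, hcg⟩ := hg
  obtain ⟨κ', hκ', hd, hdg⟩ := hg'
  have h1 : κ = κ' := by
    funext j
    have h2 := hh.map_cell (hκ.2 j)
    rw [hgg] at h2
    exact cell_unique h2 (hκ'.2 j)
  subst h1
  by_cases hi : i ∈ Set.range κ
  · obtain ⟨j, rfl⟩ := hi
    rw [hcg, hdg, hgg]
  · have h2 : c.1 i = 0 := by
      by_contra h
      exact hi ((hc i).1 (Config.mem_support.2 h))
    have h3 : d.1 i = 0 := by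
      by_contra h
      exact hi ((hd i).1 (Config.mem_support.2 h))
    rw [h2, h3, map_zero]

/-- The group splits into the translates of the elements in echelon form by representatives `p` of
`P_s / U L_s`. Each translate has as many double cosets as there are orbits of
configurations, since `P_s` normalizes `L_s`. -/
theorem card_doubleCoset [Finite F] (b b' : Module.Basis (Fin r) F V) (hs : s ≤ r)
    (H : Subgroup (V ≃ₗ[F] V)) (hH : ∀ h ∈ H, IsUnitriangular b' h) :
    Nat.card (DoubleCoset.Quotient (H : Set (V ≃ₗ[F] V)) (L b s : Set (V ≃ₗ[F] V))) =
      Nat.card {q : ConfigOrbit b' H // q.support.card = s} *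
        (U b ⊔ L b s).relIndex (P b s) := by
  rw [Subgroup.relIndex, Subgroup.index, ← Nat.card_prod]
  symm
  let C : {q : ConfigOrbit b' H // q.support.card = s} → Config b' := fun q => Quotient.out q.1
  have hC : ∀ q, Quotient.mk (configSetoid b' H) (C q) = q.1 := fun q => Quotient.out_eq _
  have hCcard : ∀ q, (C q).support.card = s := fun q => by
    have h1 : (C q).support = q.1.support := by
      rw [← hC q]
      rfl
    rw [h1, q.2]
  choose γ hγ using fun q => exists_represents b hs (C q) (hCcard q)
  have hLUL : L b s ≤ U b ⊔ L b s := le_sup_right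
  refine Nat.card_congr (Equiv.ofBijective (fun x =>
    DoubleCoset.mk H (L b s) (γ x.1 * (x.2.out : V ≃ₗ[F] V)⁻¹)) ⟨?_, ?_⟩)
  · rintro ⟨q, x⟩ ⟨q', x'⟩ heq
    obtain ⟨h, hh, l, hl, heq⟩ := (DoubleCoset.eq H (L b s) _ _).1 heq
    dsimp only at heq
    set p := x.out with hp
    set p' := x'.out with hp'
    -- both `γ q'` and `h * γ q` are in echelon form, and they differ by an element of `P_s`
    have h1 : γ q' = (h * γ q) * ((p : V ≃ₗ[F] V)⁻¹ * l * p') := by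
      rw [mul_inv_eq_iff_eq_mul] at heq
      rw [heq]
      group
    obtain ⟨κ, hκ, -⟩ := hγ q
    obtain ⟨κ', hκ', -⟩ := hγ q'
    have hlP : l ∈ P b s := hl.1
    have h2 : (p : V ≃ₗ[F] V)⁻¹ * l * p' ∈ U b ⊔ L b s := by
      rw [h1] at hκ'
      exact (hκ.mul_left (hH h hh)).mem_U_sup_L
        ((P b s).mul_mem ((P b s).mul_mem ((P b s).inv_mem p.2) hlP) p'.2) hκ'
    have h3 : (p : V ≃ₗ[F] V)⁻¹ * p' ∈ U b ⊔ L b s := by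
      have h4 := (U b ⊔ L b s).mul_mem h2 (hLUL ((L b s).inv_mem (conj_mem_L b p'.2 hl)))
      have h5 : (p : V ≃ₗ[F] V)⁻¹ * l * p' * ((p' : V ≃ₗ[F] V)⁻¹ * l * p')⁻¹ =
          (p : V ≃ₗ[F] V)⁻¹ * p' := by group
      rwa [h5] at h4
    have hx : x = x' := by
      rw [← QuotientGroup.out_eq' x, ← QuotientGroup.out_eq' x', QuotientGroup.eq]
      exact h3
    have hpp : p' = p := by rw [hp, hp', hx]
    rw [hpp] at h1
    have h4 := conj_mem_L b p.2 hl
    have h5 : ∀ i, h ((C q).1 i) = (C q').1 i := by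
      refine (hγ q).config_eq (hγ q') (fun j => ?_) (hH h hh)
      have h6 : γ q' (b (Fin.castLE hs j)) =
          h (γ q (((p : V ≃ₗ[F] V)⁻¹ * l * p) (b (Fin.castLE hs j)))) := by
        rw [h1]
        rfl
      rw [h6, (mem_L_iff b).1 h4 _ j.2]
    have hq : q = q' := Subtype.ext (by
      rw [← hC q, ← hC q']
      exact Quotient.sound ⟨h, hh, h5⟩)
    rw [hq, hx]
  · intro z
    induction z using Quotient.inductionOn with
    | _ g =>
      obtain ⟨p, hp, κ, hκ⟩ := exists_mem_P_isEchelon b b' hs g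
      let x : P b s ⧸ (U b ⊔ L b s).subgroupOf (P b s) := QuotientGroup.mk ⟨p, hp⟩
      have hx : p⁻¹ * x.out ∈ U b ⊔ L b s := by
        have h1 : QuotientGroup.mk (s := (U b ⊔ L b s).subgroupOf (P b s)) ⟨p, hp⟩ =
          QuotientGroup.mk x.out := (QuotientGroup.out_eq' x).symm
        exact (QuotientGroup.eq (s := (U b ⊔ L b s).subgroupOf (P b s))).1 h1
      have hκ' : IsEchelon b b' hs κ (g * x.out) := by
        have h1 := hκ.mul_right hx
        rwa [mul_assoc, mul_inv_cancel_left] at h1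
      obtain ⟨c, hc, hcg⟩ := hκ'.exists_represents
      let q : {q : ConfigOrbit b' H // q.support.card = s} := ⟨Quotient.mk _ c, hc⟩
      obtain ⟨h, hh, hqc⟩ := Quotient.exact (hC q)
      refine ⟨(q, x), (DoubleCoset.eq H (L b s) _ _).2 ⟨h, hh, ?_⟩⟩
      dsimp only
      let l : V ≃ₗ[F] V := (h * γ q)⁻¹ * (g * x.out)
      have hl : l ∈ L b s := (mem_L_iff b).2 fun j hj => by
        have h1 := (hγ q).apply_eq hcg hqc ⟨j, hj⟩
        change (h * γ q).symm ((g * (x.out : V ≃ₗ[F] V)) (b (Fin.castLE hs ⟨j, hj⟩))) = b j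
        rw [← h1]
        exact (h * γ q).symm_apply_apply _
      have h2 := conj_mem_L b ((P b s).inv_mem x.out.2) hl
      refine ⟨_, h2, ?_⟩
      simp only [l]
      group

end

end ReciprocalRing

end

open ReciprocalRing in
theorem theorem3p1 {F : Type*} [Field F] [Finite F] {V : Type*} [AddCommGroup V] [Module F V]
    {r : ℕ} (hr : 1 ≤ r) (b : Module.Basis (Fin r) F V)
    (H : Subgroup (V ≃ₗ[F] V)) (hH : IsUnipotentSubgroup H) (n : ℕ) :
    Module.Finite F (invariantsDeg H (-(n : ℤ))) ∧
    (Module.finrank F (invariantsDeg H (-(n : ℤ))) : ℚ) =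
      ∑ s ∈ Finset.Icc 1 r,
        (Nat.card (DoubleCoset.Quotient (H : Set (V ≃ₗ[F] V)) (L b s : Set (V ≃ₗ[F] V))) : ℚ) /
            ((U b ⊔ L b s).relIndex (P b s) : ℚ) *
          ((Ring.choose ((n : ℤ) - 1) (s - 1) : ℤ) : ℚ) := by
  obtain ⟨b', hb'⟩ := exists_basis_isUnitriangular b hH
  obtain ⟨hfin, hdim⟩ := finrank_invariantsDeg_eq_card b' H hb' n
  refine ⟨hfin, ?_⟩
  have hcount := card_configOrbit_prod_eq_sum_choose hr b' H hb' n
  rw [← hdim] at hcount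
  have hcast := congrArg (Int.cast : ℤ → ℚ) hcount
  push_cast at hcast
  rw [hcast]
  refine Finset.sum_congr rfl fun s hs => ?_
  have := finite_aut b
  have hindex : ((U b ⊔ L b s).relIndex (P b s) : ℚ) ≠ 0 :=
    Nat.cast_ne_zero.2 Subgroup.FiniteIndex.index_ne_zero
  rw [card_doubleCoset b b' (Finset.mem_Icc.1 hs).2 H hb', Nat.cast_mul,
    mul_div_cancel_right₀ _ hindex]
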